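/- Let $\mathcal I=\{1,2,3,4\}$ and let $\mathcal L=(L_i)_{i\in\mathcal I}$ be a tuple of linear maps $L_i:\mathbb R^4\to\mathbb R^2$ of the form $L_i(\mathbf x,\mathbf y)=(L_i^1(\mathbf x),L_i^2(\mathbf y))$, $\mathbf x,\mathbf y\in\mathbb R^2$, with $L_i^1,L_i^2:\mathbb R^2\to\mathbb R$ linear and surjective. Suppose that $\mathcal L$ is nondegenerate: for all $i\neq j$ the maps $\mathbf x\mapsto(L_i^1(\mathbf x),L_j^1(\mathbf x))$ and $\mathbf y\mapsto(L_i^2(\mathbf y),L_j^2(\mathbf y))$ are bijections of $\mathbb R^2$. For a tuple $\mathbf E=(E_i)_{i\in\mathcal I}$ of Lebesgue measurable subsets of $\mathbb R^2$ of finite measure, write $|\mathbf E|=(|E_i|)_{i\in\mathcal I}$ and $$\Lambda(\mathbf E)=\int_{\mathbb R^4}\prod_{i\in\mathcal I}\mathbf 1_{E_i}(L_i(z))\,dz,$$ and for $\mathbf e\in(0,\infty)^4$ let $\Theta(\mathbf e)=\sup\{\Lambda(\mathbf E):|\mathbf E|=\mathbf e\}$. Call $\mathbf e\in(0,\infty)^4$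 admissible if there is no $\mathbf e'\in(0,\infty)^4$ with $e'_j\le e_j$ for all $j$, $e'_j<e_j$ for at least one $j$, and $\Theta(\mathbf e')=\Theta(\mathbf e)$. For $E\subset\mathbb R^2$ let $E^\sharp$ be the set of all $(x,y)$ such that $m(x)=|\{t\in\mathbb R:(x,t)\in E\}|>0$ and $|y|\le\tfrac12 m(x)$ (vertical Steiner symmetrization), let $E^\flat$ be the horizontal Steiner symmetrization, defined by exchanging the roles of the two coordinates, and let $E^\dagger=(E^\sharp)^\flat$. For $\lambda>0$ let $D_\lambda(x,y)=(\lambda x,\lambda^{-1}y)$. **Theorem.** Let $\mathbf e\in(0,\infty)^4$ be admissible. Let $\mathbf E^{(n)}=(E_i^{n})_{i\in\mathcal I}$, $n\in\mathbb N$, be tuples of Lebesgue measurable subsets of $\mathbb R^2$ such that $|\mathbf E^{(n)}|=\mathbf e$ and $(E_i^{n})^\dagger=E_i^{n}$ up to Lebesgue null sets for all $n$ and $i$, and $\lim_{n\to\infty}\Lambda(\mathbf E^{(n)})=\Theta(\mathbf e)$. Then there exist a subsequence of indices $n_k$, real numbers $\lambda_k>0$, and a tuple $\mathbf E=(E_i)_{i\in\mathcal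 I}$ of Lebesgue measurable subsets of $\mathbb R^2$ of finite measure such that for every $i\in\mathcal I$ $$\lim_{k\to\infty}\big|E_i\,\Delta\,D_{\lambda_k}(E_i^{n_k})\big|=0.$$ -/

import Mathlib

open MeasureTheory Filter Set
open scoped ENNReal Topology

noncomputable section

namespace PartialSymm

/-- A `4`-tuple of linear maps `L i : ℝ⁴ → ℝ²`. A point of `ℝ⁴` is written `(𝐱, 𝐲)` with
`𝐱 = (x₁, x₂)` and `𝐲 = (y₁, y₂)`; the volume of `(ℝ × ℝ) × (ℝ × ℝ)` is Lebesgue measure. -/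
abbrev MapTuple : Type := Fin 4 → ((ℝ × ℝ) × (ℝ × ℝ) →ₗ[ℝ] ℝ × ℝ)

/-- `𝐱 ↦` first coordinate of `L i (𝐱, 0)`; the map `L_i¹` when `L i (𝐱, 𝐲) = (L_i¹ 𝐱, L_i² 𝐲)`. -/
def MapTuple.comp₁ (L : MapTuple) (i : Fin 4) : ℝ × ℝ →ₗ[ℝ] ℝ :=
  LinearMap.fst ℝ ℝ ℝ ∘ₗ L i ∘ₗ LinearMap.inl ℝ (ℝ × ℝ) (ℝ × ℝ)

/-- `𝐲 ↦` second coordinate of `L i (0, 𝐲)`; the map `L_i²` when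
`L i (𝐱, 𝐲) = (L_i¹ 𝐱, L_i² 𝐲)`. -/
def MapTuple.comp₂ (L : MapTuple) (i : Fin 4) : ℝ × ℝ →ₗ[ℝ] ℝ :=
  LinearMap.snd ℝ ℝ ℝ ∘ₗ L i ∘ₗ LinearMap.inr ℝ (ℝ × ℝ) (ℝ × ℝ)

/-- The partial symmetry hypothesis: each `L i` has the form
`L i (𝐱, 𝐲) = (L_i¹ 𝐱, L_i² 𝐲)` with `L_i¹, L_i² : ℝ² → ℝ` linear and surjective. -/
def PartialSymmetry (L : MapTuple) : Prop :=
  ∀ i, ∃ A B : ℝ × ℝ →ₗ[ℝ] ℝ, Function.Surjective A ∧ Function.Surjective B ∧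
    ∀ x y : ℝ × ℝ, L i (x, y) = (A x, B y)

/-- Under a decomposition `L i (𝐱, 𝐲) = (A 𝐱, B 𝐲)`, the map `A` is `L.comp₁ i`. -/
theorem comp₁_eq (L : MapTuple) (i : Fin 4) (A B : ℝ × ℝ →ₗ[ℝ] ℝ)
    (h : ∀ x y : ℝ × ℝ, L i (x, y) = (A x, B y)) : L.comp₁ i = A :=
  LinearMap.ext fun x => congrArg Prod.fst (h x 0)

/-- Under a decomposition `L i (𝐱, 𝐲) = (A 𝐱, B 𝐲)`, the map `B` is `L.comp₂ i`. -/
theorem comp₂_eq (L : MapTuple) (i : Fin 4) (A B : ℝ × ℝ →ₗ[ℝ] ℝ)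
    (h : ∀ x y : ℝ × ℝ, L i (x, y) = (A x, B y)) : L.comp₂ i = B :=
  LinearMap.ext fun y => congrArg Prod.snd (h 0 y)

/-- Nondegeneracy (for tuples satisfying the partial symmetry hypothesis): for `i ≠ j`,
`𝐱 ↦ (L_i¹ 𝐱, L_j¹ 𝐱)` and `𝐲 ↦ (L_i² 𝐲, L_j² 𝐲)` are bijections of `ℝ²`. -/
def Nondegenerate (L : MapTuple) : Prop :=
  ∀ i j, i ≠ j →
    Function.Bijective (fun x : ℝ × ℝ => (L.comp₁ i x, L.comp₁ j x)) ∧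
    Function.Bijective (fun y : ℝ × ℝ => (L.comp₂ i y, L.comp₂ j y))

/-- `Λ_L(𝐄) = ∫_{ℝ⁴} ∏ᵢ 1_{Eᵢ}(Lᵢ(z)) dz`, with values in `[0, ∞]`. -/
def Lam (L : MapTuple) (E : Fin 4 → Set (ℝ × ℝ)) : ℝ≥0∞ :=
  ∫⁻ z : (ℝ × ℝ) × (ℝ × ℝ), ∏ i, (E i).indicator (fun _ => (1 : ℝ≥0∞)) (L i z)

/-- `𝐄` is a tuple of Lebesgue measurable subsets of `ℝ²` with `|E i| = e i` for each `i`. -/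
def HasMeasures (E : Fin 4 → Set (ℝ × ℝ)) (e : Fin 4 → ℝ) : Prop :=
  ∀ i, NullMeasurableSet (E i) volume ∧ volume (E i) = ENNReal.ofReal (e i)

/-- `Θ(𝐞) = sup { Λ_L(𝐄) : |𝐄| = 𝐞 }`. -/
def Theta (L : MapTuple) (e : Fin 4 → ℝ) : ℝ≥0∞ :=
  ⨆ (E : Fin 4 → Set (ℝ × ℝ)) (_ : HasMeasures E e), Lam L E

/-- `(L, 𝐞)` is admissible: no `𝐞' ∈ (0, ∞)⁴` with `𝐞' < 𝐞` has `Θ(𝐞') = Θ(𝐞)`. Here `𝐞' < 𝐞` means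
`e'_j ≤ e_j` for all `j`, with strict inequality for at least one `j`. -/
def Admissible (L : MapTuple) (e : Fin 4 → ℝ) : Prop :=
  ¬ ∃ e' : Fin 4 → ℝ, (∀ i, 0 < e' i) ∧ ((∀ i, e' i ≤ e i) ∧ ∃ i, e' i < e i) ∧
    Theta L e' = Theta L e

/-- Vertical Steiner symmetrization `E^♯`. -/
def vertSteiner (E : Set (ℝ × ℝ)) : Set (ℝ × ℝ) :=
  {p | 0 < volume {t : ℝ | (p.1, t) ∈ E} ∧
    ENNReal.ofReal |p.2| ≤ volume {t : ℝ | (p.1, t) ∈ E} / 2}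

/-- Horizontal Steiner symmetrization `E^♭`. -/
def horizSteiner (E : Set (ℝ × ℝ)) : Set (ℝ × ℝ) :=
  {p | 0 < volume {t : ℝ | (t, p.2) ∈ E} ∧
    ENNReal.ofReal |p.1| ≤ volume {t : ℝ | (t, p.2) ∈ E} / 2}

/-- `E^† = (E^♯)^♭`. -/
def dagger (E : Set (ℝ × ℝ)) : Set (ℝ × ℝ) := horizSteiner (vertSteiner E)

/-- The dilation `D_t(x, y) = (t x, t⁻¹ y)`, which preserves Lebesgue measure for `t > 0`. -/
def dilation (t : ℝ) (p : ℝ × ℝ) : ℝ × ℝ := (t * p.1, t⁻¹ * p.2)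

end PartialSymm

end

namespace PartialSymm

/-! Up to null sets, a set fixed by the double symmetrization has the form |x| ≤ f(|y|) with f
nonincreasing (`exists_profile`). The dilations D_λ preserve all measures and Λ, and they are the
only source of noncompactness. They are used up by requiring that half of the mass of the 0-th set
lies in |y| ≤ 1. A diagonal argument then gives convergence of membership at every rational point,
which for sets decreasing in both coordinates forces convergence almost everywhere
(`ae_eventually_mem_iff`). It remains to see that no mass escapes to |y| = 0 or |y| = ∞
(`Splitting.tight`); at intermediate heights, t f(t) ≤ |E| confines the sets to a fixed box, and
dominated convergence applies.

Tightness rests on `Splitting.dichotomy`. Suppose a near-maximizing tuple has little mass near the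
level |y| = b, but substantial mass in some set below it and in some set above it. Cut it into the
lower tuple N and the upper tuple G. In any configuration all heights |B_j y| except possibly the
smallest are comparable, so few configurations straddle b (`Splitting.measure_crossing_le`) and Λ(N)
+ Λ(G) nearly equals Θ(e). Each of N and G lacks a fixed amount of mass in one of its sets, so by
admissibility neither attains nearly Θ(e) alone, and both contribute substantially. A tuple whose
0-th set stays in |xy| ≤ ρ contributes little (`Splitting.exists_hyperbola_bound`). Hence N_0 and
G_0 each contain a box of area comparable to ρ, and a dilation of G makes these boxes overlap.
Translating G along a vector in the kernel of L_0 separates the configurations of N from those of G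
without moving G_0 (`Splitting.Lam_add_le_Theta`). The union nearly attains Θ(e) with a strictly
smaller 0-th set, which contradicts admissibility.

A level with little mass nearby exists within a bounded range of scales on either side of 1, by
pigeonhole (`exists_small_band`); the normalization decides which alternative of the dichotomy holds
there. -/

/-! ### Splitting into horizontal and vertical functionals; control of Λ by two of the sets -/

/-- The pair maps of a family of functionals push Lebesgue measure to at most `C` times it. -/
def PairBound (A : Fin 4 → ℝ × ℝ →ₗ[ℝ] ℝ) (C : ℝ≥0∞) : Prop :=
  ∀ i j, i ≠ j → Measure.map (fun x => (A i x, A j x)) volume ≤ C • volume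

theorem measurable_functional (A : ℝ × ℝ →ₗ[ℝ] ℝ) : Measurable A :=
  A.continuous_of_finiteDimensional.measurable

theorem exists_pairBound (A : Fin 4 → ℝ × ℝ →ₗ[ℝ] ℝ)
    (hA : ∀ i j, i ≠ j → Function.Bijective (fun x => (A i x, A j x))) :
    ∃ C : ℝ≥0∞, C ≠ ∞ ∧ PairBound A C := by
  refine ⟨∑ i, ∑ j, ENNReal.ofReal |(LinearMap.det ((A i).prod (A j)))⁻¹|, ?_, ?_⟩
  · simp [ENNReal.sum_eq_top]
  · intro i j hij
    have hb : Function.Bijective ((A i).prod (A j)) := hA i j hij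
    have hdet : LinearMap.det ((A i).prod (A j)) ≠ 0 := by
      have := (LinearEquiv.ofBijective _ hb).isUnit_det'
      exact this.ne_zero
    have := Measure.map_linearMap_addHaar_eq_smul_addHaar (volume : Measure (ℝ × ℝ)) hdet
    have h2 : (fun x => (A i x, A j x)) = ((A i).prod (A j)) := rfl
    rw [h2, this]
    have hle : ENNReal.ofReal |(LinearMap.det ((A i).prod (A j)))⁻¹| ≤
        ∑ i, ∑ j, ENNReal.ofReal |(LinearMap.det ((A i).prod (A j)))⁻¹| :=
      (Finset.single_le_sum (f := fun j => ENNReal.ofReal |(LinearMap.det ((A i).prod (A j)))⁻¹|)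
        (fun _ _ => zero_le) (Finset.mem_univ j)).trans
      (Finset.single_le_sum
        (f := fun i => ∑ j, ENNReal.ofReal |(LinearMap.det ((A i).prod (A j)))⁻¹|)
        (fun _ _ => zero_le) (Finset.mem_univ i))
    intro s
    simp only [Measure.smul_apply, smul_eq_mul]
    gcongr

theorem PairBound.lintegral_le {A : Fin 4 → ℝ × ℝ →ₗ[ℝ] ℝ} {C : ℝ≥0∞} (h : PairBound A C)
    {i j : Fin 4} (hij : i ≠ j) {g : ℝ × ℝ → ℝ≥0∞} (hg : Measurable g) :
    ∫⁻ x, g (A i x, A j x) ≤ C * ∫⁻ p, g p := by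
  have hm : Measurable (fun x => (A i x, A j x)) :=
    (measurable_functional _).prodMk (measurable_functional _)
  rw [← lintegral_map hg hm, ← smul_eq_mul, ← lintegral_smul_measure]
  exact lintegral_mono' (h i j hij) le_rfl

theorem PairBound.measure_le {A : Fin 4 → ℝ × ℝ →ₗ[ℝ] ℝ} {C : ℝ≥0∞} (h : PairBound A C)
    {i j : Fin 4} (hij : i ≠ j) {s t : Set ℝ} (hs : MeasurableSet s) (ht : MeasurableSet t) :
    volume {x | A i x ∈ s ∧ A j x ∈ t} ≤ C * (volume s * volume t) := by
  have hm : Measurable (fun x => (A i x, A j x)) :=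
    (measurable_functional _).prodMk (measurable_functional _)
  have := h i j hij (s ×ˢ t)
  rw [Measure.map_apply hm (hs.prod ht), Measure.smul_apply, Measure.volume_eq_prod,
    Measure.prod_prod] at this
  exact this

theorem volume_abs_le (s : ℝ≥0∞) : volume {u : ℝ | ENNReal.ofReal |u| ≤ s} = 2 * s := by
  induction s with
  | top => simp
  | coe r =>
    have : {u : ℝ | ENNReal.ofReal |u| ≤ r} = Icc (-(r : ℝ)) r := by
      ext u
      simp [ENNReal.ofReal_le_coe, abs_le]
    rw [this, Real.volume_Icc, sub_neg_eq_add, ← two_mul, ENNReal.ofReal_mul (by norm_num)]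
    simp

theorem measurableSet_abs_le (s : ℝ≥0∞) : MeasurableSet {u : ℝ | ENNReal.ofReal |u| ≤ s} :=
  measurableSet_le (by fun_prop) (by fun_prop)

/-- Points of `ℝ⁴` mapped into `E i` by every `L i`. -/
def config (L : MapTuple) (E : Fin 4 → Set (ℝ × ℝ)) : Set ((ℝ × ℝ) × (ℝ × ℝ)) :=
  {z | ∀ i, L i z ∈ E i}

/-- `L` splits into the functionals `A i`, `B i`, whose pair maps are bounded by `C` on measures. -/
structure Splitting (L : MapTuple) (A B : Fin 4 → ℝ × ℝ →ₗ[ℝ] ℝ) (C : ℝ≥0∞) : Prop where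
  apply : ∀ i x y, L i (x, y) = (A i x, B i y)
  ne_top : C ≠ ∞
  bij₁ : ∀ i j, i ≠ j → Function.Bijective (fun x => (A i x, A j x))
  bij₂ : ∀ i j, i ≠ j → Function.Bijective (fun x => (B i x, B j x))
  bound₁ : PairBound A C
  bound₂ : PairBound B C

theorem PairBound.mono {A : Fin 4 → ℝ × ℝ →ₗ[ℝ] ℝ} {C C' : ℝ≥0∞} (h : PairBound A C)
    (hC : C ≤ C') : PairBound A C' := fun i j hij s => (h i j hij s).trans (by
      simp only [Measure.smul_apply, smul_eq_mul]; gcongr)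

theorem exists_splitting (L : MapTuple) (hsymm : PartialSymmetry L) (hnd : Nondegenerate L) :
    ∃ A B C, Splitting L A B C := by
  choose A B _ _ h using hsymm
  have hA : ∀ i, L.comp₁ i = A i := fun i => comp₁_eq L i _ _ (h i)
  have hB : ∀ i, L.comp₂ i = B i := fun i => comp₂_eq L i _ _ (h i)
  have h1 : ∀ i j, i ≠ j → Function.Bijective (fun x => (A i x, A j x)) := by
    intro i j hij
    have := (hnd i j hij).1
    rwa [hA, hA] at this
  have h2 : ∀ i j, i ≠ j → Function.Bijective (fun x => (B i x, B j x)) := by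
    intro i j hij
    have := (hnd i j hij).2
    rwa [hB, hB] at this
  obtain ⟨C₁, hC₁, b₁⟩ := exists_pairBound A h1
  obtain ⟨C₂, hC₂, b₂⟩ := exists_pairBound B h2
  exact ⟨A, B, max C₁ C₂, h, by simp [hC₁, hC₂], h1, h2,
    b₁.mono (le_max_left _ _), b₂.mono (le_max_right _ _)⟩

theorem measurable_map (L : MapTuple) (i : Fin 4) : Measurable (L i) :=
  (L i).continuous_of_finiteDimensional.measurable

theorem measurableSet_config (L : MapTuple) {E : Fin 4 → Set (ℝ × ℝ)}
    (hE : ∀ i, MeasurableSet (E i)) : MeasurableSet (config L E) := by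
  have : config L E = ⋂ i, L i ⁻¹' E i := by ext; simp [config]
  rw [this]
  exact MeasurableSet.iInter fun i => measurable_map L i (hE i)

theorem prod_indicator (L : MapTuple) (E : Fin 4 → Set (ℝ × ℝ)) (z : (ℝ × ℝ) × (ℝ × ℝ)) :
    ∏ i, (E i).indicator (fun _ => (1 : ℝ≥0∞)) (L i z) =
      (config L E).indicator (fun _ => (1 : ℝ≥0∞)) z := by
  classical
  by_cases h : z ∈ config L E
  · rw [indicator_of_mem h]
    exact Finset.prod_eq_one fun i _ => indicator_of_mem (h i) _
  · rw [indicator_of_notMem h]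
    simp only [config, mem_ofPred_eq, not_forall] at h
    obtain ⟨i, hi⟩ := h
    exact Finset.prod_eq_zero (Finset.mem_univ i) (indicator_of_notMem hi _)

theorem Lam_eq (L : MapTuple) {E : Fin 4 → Set (ℝ × ℝ)} (hE : ∀ i, MeasurableSet (E i)) :
    Lam L E = volume (config L E) := by
  simp only [Lam, prod_indicator]
  rw [lintegral_indicator (measurableSet_config L hE)]
  simp

theorem Lam_mono (L : MapTuple) {E F : Fin 4 → Set (ℝ × ℝ)} (h : ∀ i, E i ⊆ F i) :
    Lam L E ≤ Lam L F := by
  simp only [Lam, prod_indicator]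
  refine lintegral_mono fun z => ?_
  exact indicator_le_indicator_of_subset (fun z (hz : ∀ i, L i z ∈ E i) i => h i (hz i))
    (fun _ => zero_le) z

variable {L : MapTuple} {A B : Fin 4 → ℝ × ℝ →ₗ[ℝ] ℝ} {C : ℝ≥0∞}

/-- For fixed y the admissible x are controlled by the product of the horizontal slice lengths of P
and Q, because (A_k, A_l) is a linear isomorphism. The isomorphism (B_k, B_l) then integrates these
slice lengths independently. -/
theorem Splitting.measure_pair_le_of_measurableSet (h : Splitting L A B C) {k l : Fin 4}
    (hkl : k ≠ l) {P Q : Set (ℝ × ℝ)} (hP : MeasurableSet P) (hQ : MeasurableSet Q) :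
    volume {z | L k z ∈ P ∧ L l z ∈ Q} ≤ C * C * (volume P * volume Q) := by
  have hm : MeasurableSet {z | L k z ∈ P ∧ L l z ∈ Q} :=
    (measurable_map L k hP).inter (measurable_map L l hQ)
  rw [Measure.volume_eq_prod (ℝ × ℝ) (ℝ × ℝ), Measure.prod_apply_symm hm]
  set p : ℝ → ℝ≥0∞ := fun v => volume ((fun u => (u, v)) ⁻¹' P) with hp
  set q : ℝ → ℝ≥0∞ := fun v => volume ((fun u => (u, v)) ⁻¹' Q) with hq
  have hpm : Measurable p := measurable_measure_prodMk_right hP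
  have hqm : Measurable q := measurable_measure_prodMk_right hQ
  calc ∫⁻ y, volume ((fun x => (x, y)) ⁻¹' {z | L k z ∈ P ∧ L l z ∈ Q})
      ≤ ∫⁻ y, C * (p (B k y) * q (B l y)) := by
        refine lintegral_mono fun y => ?_
        have := h.bound₁.measure_le hkl (s := (fun u => (u, B k y)) ⁻¹' P)
          (t := (fun u => (u, B l y)) ⁻¹' Q) (measurable_prodMk_right hP)
          (measurable_prodMk_right hQ)
        simpa [h.apply] using this
    _ = C * ∫⁻ y, (p (B k y) * q (B l y)) := lintegral_const_mul' _ _ h.ne_top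
    _ ≤ C * (C * ∫⁻ w : ℝ × ℝ, p w.1 * q w.2) := by
        gcongr
        exact h.bound₂.lintegral_le hkl (g := fun w => p w.1 * q w.2) (by fun_prop)
    _ = C * C * (volume P * volume Q) := by
        rw [Measure.volume_eq_prod ℝ ℝ, lintegral_prod_mul hpm.aemeasurable hqm.aemeasurable,
          Measure.prod_apply_symm hP, Measure.prod_apply_symm hQ, mul_assoc]

theorem Splitting.measure_pair_le (h : Splitting L A B C) {k l : Fin 4} (hkl : k ≠ l)
    (P Q : Set (ℝ × ℝ)) :
    volume {z | L k z ∈ P ∧ L l z ∈ Q} ≤ C * C * (volume P * volume Q) := by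
  rw [← measure_toMeasurable P, ← measure_toMeasurable Q]
  refine le_trans (measure_mono ?_) (h.measure_pair_le_of_measurableSet hkl
    (measurableSet_toMeasurable _ P) (measurableSet_toMeasurable _ Q))
  exact fun z hz => ⟨subset_toMeasurable _ _ hz.1, subset_toMeasurable _ _ hz.2⟩

theorem Splitting.ae_comp (h : Splitting L A B C) (k : Fin 4) {P : ℝ × ℝ → Prop}
    (hP : ∀ᵐ p, P p) : ∀ᵐ z, P (L k z) := by
  obtain ⟨l, hl⟩ : ∃ l, k ≠ l := (exists_ne k).imp fun _ => Ne.symm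
  -- The second factor has infinite measure, which is harmless since 0 · ∞ = 0.
  have := h.measure_pair_le hl {p | ¬ P p} univ
  rw [ae_iff.1 hP] at this
  rw [ae_iff]
  simpa using this

theorem Splitting.Lam_congr (h : Splitting L A B C) {E F : Fin 4 → Set (ℝ × ℝ)}
    (hEF : ∀ i, E i =ᵐ[volume] F i) : Lam L E = Lam L F := by
  refine lintegral_congr_ae ?_
  have : ∀ᵐ z, ∀ i, (L i z ∈ E i ↔ L i z ∈ F i) := by
    rw [ae_all_iff]
    intro i
    exact h.ae_comp i (P := fun p => p ∈ E i ↔ p ∈ F i) ((hEF i).mem_iff)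
  filter_upwards [this] with z hz
  refine Finset.prod_congr rfl fun i _ => ?_
  by_cases hi : L i z ∈ E i
  · rw [indicator_of_mem hi, indicator_of_mem ((hz i).1 hi)]
  · rw [indicator_of_notMem hi, indicator_of_notMem (fun h' => hi ((hz i).2 h'))]

theorem Splitting.Lam_le (h : Splitting L A B C) (E : Fin 4 → Set (ℝ × ℝ)) {k l : Fin 4}
    (hkl : k ≠ l) : Lam L E ≤ C * C * (volume (E k) * volume (E l)) := by
  calc Lam L E ≤ Lam L (fun i => toMeasurable volume (E i)) :=
        Lam_mono L fun i => subset_toMeasurable _ _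
    _ = volume (config L fun i => toMeasurable volume (E i)) :=
        Lam_eq L fun i => measurableSet_toMeasurable _ _
    _ ≤ volume {z | L k z ∈ toMeasurable volume (E k) ∧ L l z ∈ toMeasurable volume (E l)} :=
        measure_mono fun z hz => ⟨hz k, hz l⟩
    _ ≤ _ := by
        refine (h.measure_pair_le hkl _ _).trans_eq ?_
        rw [measure_toMeasurable, measure_toMeasurable]

theorem Splitting.Theta_ne_top (h : Splitting L A B C) (e : Fin 4 → ℝ) : Theta L e ≠ ∞ := by
  have hne : C * C * (ENNReal.ofReal (e 0) * ENNReal.ofReal (e 1)) ≠ ∞ :=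
    ENNReal.mul_ne_top (ENNReal.mul_ne_top h.ne_top h.ne_top)
      (ENNReal.mul_ne_top ENNReal.ofReal_ne_top ENNReal.ofReal_ne_top)
  refine ne_top_of_le_ne_top hne (iSup₂_le fun E hE => ?_)
  rw [← (hE 0).2, ← (hE 1).2]
  exact h.Lam_le E (by decide)

/-! ### Strips, monotonicity of Θ, and the gap provided by admissibility -/

/-- Horizontal strip `|y| ≤ r`. -/
def strip (r : ℝ) : Set (ℝ × ℝ) := {p | |p.2| ≤ r}

theorem measurableSet_strip (r : ℝ) : MeasurableSet (strip r) :=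
  measurableSet_le (by fun_prop) (by fun_prop)

theorem strip_mono : Monotone strip := fun _ _ hrs _ hp => le_trans hp hrs

theorem mem_strip {r : ℝ} {p : ℝ × ℝ} : p ∈ strip r ↔ |p.2| ≤ r := Iff.rfl

theorem volume_snd_abs_eq (r : ℝ) : volume {p : ℝ × ℝ | |p.2| = r} = 0 := by
  have : {p : ℝ × ℝ | |p.2| = r} ⊆ (univ : Set ℝ) ×ˢ ({r, -r} : Set ℝ) := by
    intro p hp
    simp only [mem_ofPred_eq] at hp
    rcases abs_choice p.2 with h | h <;> simp <;> [left; right] <;> linarith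
  refine measure_mono_null this ?_
  rw [Measure.volume_eq_prod, Measure.prod_prod, 
    (Set.toFinite ({r, -r} : Set ℝ)).measure_zero, mul_zero]

/-- Intermediate value theorem: r ↦ |V ∩ {|y| ≤ r}| is continuous because horizontal lines are null.
Finiteness is assumed only on strips, so V itself may have infinite measure. -/
theorem exists_strip_measure_eq {V : Set (ℝ × ℝ)} (hV : MeasurableSet V)
    (hfin : ∀ r, volume (V ∩ strip r) ≠ ∞) {c : ℝ≥0∞} (hc0 : 0 < c) (hc : c < volume V) :
    ∃ r, 0 < r ∧ volume (V ∩ strip r) = c := by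
  set g : ℝ → ℝ≥0∞ := fun r => volume (V ∩ strip r) with hg
  have hmono : Monotone g := fun r s hrs =>
    measure_mono (inter_subset_inter_right _ (strip_mono hrs))
  have hmeas : ∀ r, MeasurableSet (V ∩ strip r) := fun r => hV.inter (measurableSet_strip r)
  have hg0 : g 0 = 0 := by
    refine measure_mono_null (fun p hp => ?_) (volume_snd_abs_eq 0)
    exact le_antisymm hp.2 (abs_nonneg _)
  obtain ⟨R, hR⟩ : ∃ n : ℕ, c < g n := by
    have hU : V = ⋃ n : ℕ, V ∩ strip n := by
      ext p
      simp only [mem_iUnion, mem_inter_iff, strip, mem_ofPred_eq, exists_and_left]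
      exact ⟨fun h => ⟨h, exists_nat_ge _⟩, fun h => h.1⟩
    have hmon : Monotone fun n : ℕ => V ∩ strip n := fun n m hnm =>
      inter_subset_inter_right _ (strip_mono (by exact_mod_cast hnm))
    rw [hU, hmon.measure_iUnion] at hc
    exact lt_iSup_iff.1 hc
  have hcont : Continuous g := by
    refine continuous_iff_continuousAt.2 fun r => ?_
    rw [continuousAt_iff_continuous_left'_right']
    constructor
    · rw [ContinuousWithinAt]
      have h1 : g r = volume (⋃ s : Iio r, V ∩ strip s) := by
        refine le_antisymm ?_ (measure_mono (iUnion_subset fun s =>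
          inter_subset_inter_right _ (strip_mono s.2.le)))
        have : V ∩ strip r ⊆ (⋃ s : Iio r, V ∩ strip s) ∪ {p | |p.2| = r} := by
          intro p hp
          rcases (show |p.2| ≤ r from hp.2).lt_or_eq with h | h
          · exact Or.inl (mem_iUnion.2 ⟨⟨_, h⟩, hp.1, le_refl |p.2|⟩)
          · exact Or.inr h
        refine (measure_mono this).trans ((measure_union_le _ _).trans ?_)
        rw [volume_snd_abs_eq, add_zero]
      have h2 := hmono.tendsto_nhdsLT r
      convert h2
      have hm : Monotone fun s : Iio r => V ∩ strip s := fun s t hst =>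
        inter_subset_inter_right _ (strip_mono hst)
      rw [h1, hm.measure_iUnion, sSup_image, iSup_subtype]
    · rw [ContinuousWithinAt]
      have h2 := hmono.tendsto_nhdsGT r
      convert h2
      have h1 : V ∩ strip r = ⋂ s : Ioi r, V ∩ strip s := by
        ext p
        simp only [mem_inter_iff, mem_iInter, Subtype.forall, mem_Ioi, strip, mem_ofPred_eq]
        constructor
        · exact fun h s hs => ⟨h.1, h.2.trans hs.le⟩
        · intro h
          exact ⟨(h (r + 1) (by linarith)).1, le_of_forall_gt_imp_ge_of_dense fun s hs => (h s hs).2⟩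
      rw [hg]
      simp only
      have hm : Monotone fun s : Ioi r => V ∩ strip s := fun s t hst =>
        inter_subset_inter_right _ (strip_mono hst)
      rw [h1, hm.measure_iInter (fun s => (hmeas s).nullMeasurableSet)
        ⟨⟨r + 1, mem_Ioi.2 (by linarith)⟩, hfin (r + 1)⟩, sInf_image, iInf_subtype]
  obtain ⟨r, hr, hrc⟩ := intermediate_value_Icc (Nat.cast_nonneg R) hcont.continuousOn
    ⟨hg0.le.trans hc0.le, hR.le⟩
  refine ⟨r, lt_of_le_of_ne hr.1 ?_, hrc⟩
  rintro rfl
  rw [hg0] at hrc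
  exact hc0.ne hrc

theorem exists_superset_measure_eq {U : Set (ℝ × ℝ)} (hU : MeasurableSet U) {c : ℝ≥0∞}
    (hc : c ≠ ∞) (hUc : volume U ≤ c) :
    ∃ V, MeasurableSet V ∧ U ⊆ V ∧ volume V = c := by
  rcases hUc.eq_or_lt with h | h
  · exact ⟨U, hU, subset_rfl, h⟩
  have hUfin : volume U ≠ ∞ := ne_top_of_le_ne_top hc hUc
  -- A reservoir of infinite measure disjoint from U, with finite measure in every strip; the
  -- missing mass is cut out of it.
  set T : Set (ℝ × ℝ) := (Icc 0 1 ×ˢ univ) \ U with hT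
  have hTm : MeasurableSet T := (measurableSet_Icc.prod MeasurableSet.univ).diff hU
  have hTtop : volume T = ∞ := by
    have : volume (Icc (0 : ℝ) 1 ×ˢ (univ : Set ℝ)) ≤ volume T + volume U := by
      refine (measure_mono ?_).trans (measure_union_le T U)
      intro p hp
      by_cases hpU : p ∈ U
      · exact Or.inr hpU
      · exact Or.inl ⟨hp, hpU⟩
    rw [Measure.volume_eq_prod, Measure.prod_prod] at this
    simp at this
    exact this.resolve_right hUfin
  have hTfin : ∀ r, volume (T ∩ strip r) ≠ ∞ := by
    intro r
    have : T ∩ strip r ⊆ Icc (0 : ℝ) 1 ×ˢ Icc (-r) r := fun p hp => ⟨hp.1.1.1, abs_le.1 hp.2⟩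
    refine ne_top_of_le_ne_top ?_ (measure_mono this)
    rw [Measure.volume_eq_prod, Measure.prod_prod, Real.volume_Icc, Real.volume_Icc]
    exact ENNReal.mul_ne_top ENNReal.ofReal_ne_top ENNReal.ofReal_ne_top
  obtain ⟨r, -, hr⟩ := exists_strip_measure_eq hTm hTfin (c := c - volume U)
    (tsub_pos_of_lt h) (by rw [hTtop]; exact (tsub_le_self.trans_lt hc.lt_top))
  refine ⟨U ∪ (T ∩ strip r), hU.union (hTm.inter (measurableSet_strip r)), subset_union_left, ?_⟩
  rw [measure_union ?_ (hTm.inter (measurableSet_strip r)), hr, add_tsub_cancel_of_le hUc]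
  exact disjoint_left.2 fun p hp hp' => hp'.1.2 hp

/-- The supremum defining Θ prescribes the measures exactly; enlarging the sets shows that upper
bounds on the measures suffice. -/
theorem Lam_le_Theta (L : MapTuple) {U : Fin 4 → Set (ℝ × ℝ)} {e : Fin 4 → ℝ}
    (hUe : ∀ i, volume (U i) ≤ ENNReal.ofReal (e i)) : Lam L U ≤ Theta L e := by
  have := fun i => exists_superset_measure_eq (measurableSet_toMeasurable volume (U i))
    (ENNReal.ofReal_ne_top (r := e i)) (by rw [measure_toMeasurable]; exact hUe i)
  choose V hVm hUV hV using this
  refine (Lam_mono L fun i => (subset_toMeasurable volume (U i)).trans (hUV i)).trans ?_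
  exact le_iSup₂ (f := fun E (_ : HasMeasures E e) => Lam L E) V
    fun i => ⟨(hVm i).nullMeasurableSet, hV i⟩

theorem Theta_mono (L : MapTuple) {e e' : Fin 4 → ℝ} (h : ∀ i, e' i ≤ e i) :
    Theta L e' ≤ Theta L e :=
  iSup₂_le fun _ hE => Lam_le_Theta L fun i => (hE i).2.trans_le (ENNReal.ofReal_le_ofReal (h i))

/-- Admissibility only says that two values of Θ differ. Monotonicity turns this into a strict
inequality, hence into a quantitative loss γ. -/
theorem Admissible.exists_gap {e : Fin 4 → ℝ} (hadm : Admissible L e) (he : ∀ i, 0 < e i)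
    (h : Splitting L A B C) (j : Fin 4) {δ : ℝ} (hδ : 0 < δ) (hδe : δ < e j) :
    ∃ γ : ℝ≥0∞, 0 < γ ∧ γ ≠ ∞ ∧
      Theta L (Function.update e j (e j - δ)) + γ ≤ Theta L e := by
  have hle : ∀ i, Function.update e j (e j - δ) i ≤ e i := by
    intro i
    rcases eq_or_ne i j with rfl | hi
    · simp [hδ.le]
    · simp [hi]
  have hlt : Theta L (Function.update e j (e j - δ)) < Theta L e := by
    refine lt_of_le_of_ne (Theta_mono L hle) fun heq => hadm ⟨_, ?_, ⟨hle, j, ?_⟩, heq⟩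
    · intro i
      rcases eq_or_ne i j with rfl | hi
      · simp [hδe]
      · simp [hi, he i]
    · simp [hδ]
  refine ⟨_, tsub_pos_of_lt hlt, ?_, (add_tsub_cancel_of_le hlt.le).le⟩
  exact ne_top_of_le_ne_top (h.Theta_ne_top e) tsub_le_self

/-! ### Sets bounded by a nonincreasing profile -/

/-- The set `|x| ≤ f |y|`. -/
def profileSet (f : ℝ → ℝ≥0∞) : Set (ℝ × ℝ) := {p | ENNReal.ofReal |p.1| ≤ f |p.2|}

theorem mem_profileSet {f : ℝ → ℝ≥0∞} {p : ℝ × ℝ} :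
    p ∈ profileSet f ↔ ENNReal.ofReal |p.1| ≤ f |p.2| := Iff.rfl

theorem measurableSet_profileSet {f : ℝ → ℝ≥0∞} (hf : Measurable f) :
    MeasurableSet (profileSet f) :=
  measurableSet_le (by fun_prop) (by fun_prop)

theorem volume_profileSet_inter {f : ℝ → ℝ≥0∞} (hf : Measurable f) {I : Set ℝ}
    (hI : MeasurableSet I) :
    volume (profileSet f ∩ {p | p.2 ∈ I}) = 2 * ∫⁻ v, I.indicator 1 v * f |v| := by
  have hm : MeasurableSet (profileSet f ∩ {p : ℝ × ℝ | p.2 ∈ I}) :=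
    (measurableSet_profileSet hf).inter (measurable_snd hI)
  rw [Measure.volume_eq_prod, Measure.prod_apply_symm hm, ← lintegral_const_mul' _ _ (by simp)]
  refine lintegral_congr fun v => ?_
  by_cases hv : v ∈ I
  · rw [indicator_of_mem hv, Pi.one_apply, one_mul, ← volume_abs_le]
    congr 1
    ext u
    simp [mem_profileSet, hv]
  · rw [indicator_of_notMem hv, zero_mul, mul_zero]
    convert measure_empty (μ := (volume : Measure ℝ))
    ext u
    simp [hv]

theorem volume_profileSet {f : ℝ → ℝ≥0∞} (hf : Measurable f) :
    volume (profileSet f) = 2 * ∫⁻ v, f |v| := by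
  have := volume_profileSet_inter hf MeasurableSet.univ
  simpa using this

theorem volume_box {a b c d : ℝ} :
    volume {p : ℝ × ℝ | p.1 ∈ Icc a b ∧ p.2 ∈ Ioc c d} =
      ENNReal.ofReal (b - a) * ENNReal.ofReal (d - c) := by
  have : {p : ℝ × ℝ | p.1 ∈ Icc a b ∧ p.2 ∈ Ioc c d} = Icc a b ×ˢ Ioc c d := rfl
  rw [this, Measure.volume_eq_prod, Measure.prod_prod, Real.volume_Icc, Real.volume_Ioc]

theorem profile_mul_le {f : ℝ → ℝ≥0∞} (hf : Antitone f) (t : ℝ) :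
    f t * ENNReal.ofReal t ≤ volume (profileSet f) := by
  rw [volume_profileSet hf.measurable]
  calc f t * ENNReal.ofReal t = ∫⁻ v in Ioc 0 t, f t := by simp
    _ ≤ ∫⁻ v in Ioc 0 t, f |v| := by
        refine setLIntegral_mono' measurableSet_Ioc fun v hv => hf ?_
        rw [abs_of_pos hv.1]; exact hv.2
    _ ≤ ∫⁻ v, f |v| := setLIntegral_le_lintegral _ _
    _ ≤ _ := le_mul_of_one_le_left zero_le (by norm_num)

theorem profile_le_div {f : ℝ → ℝ≥0∞} (hf : Antitone f) {t E : ℝ} (ht : 0 < t)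
    (hE : volume (profileSet f) ≤ ENNReal.ofReal E) : f t ≤ ENNReal.ofReal E / ENNReal.ofReal t := by
  rw [ENNReal.le_div_iff_mul_le (by simp [ht]) (by simp)]
  exact (profile_mul_le hf t).trans hE

/-! ### Estimates for the measure of special sets of configurations -/

/-- Since (B_i, B_k) are coordinates, B_j is a combination of them and is dominated by the larger
one. Applied with i the index of least height, this makes all the other heights comparable to one
another. -/
theorem exists_comparable {B : Fin 4 → ℝ × ℝ →ₗ[ℝ] ℝ}
    (hB : ∀ i j, i ≠ j → Function.Bijective (fun x => (B i x, B j x))) :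
    ∃ κ : ℝ, 0 < κ ∧ κ ≤ 1 / 2 ∧ ∀ i j k, k ≠ i → ∀ y, |B i y| ≤ |B k y| →
      κ * |B j y| ≤ |B k y| := by
  have : ∀ i j k, ∃ M : ℝ, 0 ≤ M ∧ (k ≠ i → ∀ y, |B i y| ≤ |B k y| → |B j y| ≤ M * |B k y|) := by
    intro i j k
    by_cases hki : k = i
    · exact ⟨0, le_rfl, fun h => absurd hki h⟩
    have hb : Function.Bijective ((B i).prod (B k)) := hB i k (Ne.symm hki)
    set T := LinearEquiv.ofBijective _ hb with hT
    refine ⟨|B j (T.symm (1, 0))| + |B j (T.symm (0, 1))|, by positivity, fun _ y hy => ?_⟩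
    have h1 : B j y = B i y * B j (T.symm (1, 0)) + B k y * B j (T.symm (0, 1)) := by
      have h2 : T y = B i y • ((1, 0) : ℝ × ℝ) + B k y • ((0, 1) : ℝ × ℝ) := by
        simp [hT]
      have h3 : y = B i y • T.symm (1, 0) + B k y • T.symm (0, 1) := by
        rw [← map_smul, ← map_smul, ← map_add, ← h2, LinearEquiv.symm_apply_apply]
      conv_lhs => rw [h3]
      simp
    rw [h1]
    calc _ ≤ |B i y| * |B j (T.symm (1, 0))| + |B k y| * |B j (T.symm (0, 1))| := by
          rw [← abs_mul, ← abs_mul]; exact abs_add_le _ _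
      _ ≤ |B k y| * |B j (T.symm (1, 0))| + |B k y| * |B j (T.symm (0, 1))| := by gcongr
      _ = _ := by ring
  choose M hM0 hM using this
  set S := ∑ i, ∑ j, ∑ k, M i j k with hS
  have hS0 : 0 ≤ S := Finset.sum_nonneg fun _ _ => Finset.sum_nonneg fun _ _ =>
    Finset.sum_nonneg fun _ _ => hM0 _ _ _
  -- Adding 2 ensures κ ≤ 1/2, which `Splitting.dichotomy` needs to fit a box into a band.
  refine ⟨1 / (S + 2), by positivity, one_div_le_one_div_of_le (by norm_num) (by linarith), ?_⟩
  intro i j k hki y hy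
  have h1 := hM i j k hki y hy
  have h2 : M i j k ≤ S := by
    calc M i j k ≤ ∑ k, M i j k :=
          Finset.single_le_sum (f := fun k => M i j k) (fun _ _ => hM0 _ _ _) (Finset.mem_univ k)
      _ ≤ ∑ j, ∑ k, M i j k := Finset.single_le_sum (f := fun j => ∑ k, M i j k)
          (fun _ _ => Finset.sum_nonneg fun _ _ => hM0 _ _ _) (Finset.mem_univ j)
      _ ≤ S := Finset.single_le_sum (f := fun i => ∑ j, ∑ k, M i j k)
          (fun _ _ => Finset.sum_nonneg fun _ _ => Finset.sum_nonneg fun _ _ => hM0 _ _ _)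
          (Finset.mem_univ i)
  rw [one_div, inv_mul_le_iff₀ (by positivity)]
  have := abs_nonneg (B k y)
  nlinarith

/-- Horizontal integration uses the coordinates (A_k, A_l), vertical integration the coordinates
(B_i, B_l). The index i may differ from k, which allows the vertical variable of least height to be
integrated out separately. -/
theorem Splitting.measure_triple_le (h : Splitting L A B C) {i k l : Fin 4} (hkl : k ≠ l)
    (hil : i ≠ l) {f : ℝ → ℝ≥0∞} (hf : Measurable f) {Φ : ℝ × ℝ → ℝ≥0∞} (hΦ : Measurable Φ) :
    volume {z : (ℝ × ℝ) × (ℝ × ℝ) | ENNReal.ofReal |A k z.1| ≤ Φ (B i z.2, B l z.2) ∧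
      ENNReal.ofReal |A l z.1| ≤ f |B l z.2|} ≤
      4 * C * C * ∫⁻ v, (∫⁻ u, Φ (u, v)) * f |v| := by
  have mA := fun i => measurable_functional (A i)
  have mB := fun i => measurable_functional (B i)
  have hm : MeasurableSet {z : (ℝ × ℝ) × (ℝ × ℝ) |
      ENNReal.ofReal |A k z.1| ≤ Φ (B i z.2, B l z.2) ∧ ENNReal.ofReal |A l z.1| ≤ f |B l z.2|} := by
    have mAk := (mA k).comp (measurable_fst : Measurable (Prod.fst : (ℝ × ℝ) × (ℝ × ℝ) → _))
    have mAl := (mA l).comp (measurable_fst : Measurable (Prod.fst : (ℝ × ℝ) × (ℝ × ℝ) → _))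
    have mBi := (mB i).comp (measurable_snd : Measurable (Prod.snd : (ℝ × ℝ) × (ℝ × ℝ) → _))
    have mBl := (mB l).comp (measurable_snd : Measurable (Prod.snd : (ℝ × ℝ) × (ℝ × ℝ) → _))
    refine (measurableSet_le ?_ (hΦ.comp (mBi.prodMk mBl))).inter
      (measurableSet_le ?_ (hf.comp ?_))
    · exact ENNReal.measurable_ofReal.comp (measurable_abs.comp mAk)
    · exact ENNReal.measurable_ofReal.comp (measurable_abs.comp mAl)
    · exact measurable_abs.comp mBl
  rw [Measure.volume_eq_prod (ℝ × ℝ) (ℝ × ℝ), Measure.prod_apply_symm hm]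
  calc _ ≤ ∫⁻ y, C * ((2 * Φ (B i y, B l y)) * (2 * f |B l y|)) := by
        refine lintegral_mono fun y => ?_
        have := h.bound₁.measure_le hkl (measurableSet_abs_le (Φ (B i y, B l y)))
          (measurableSet_abs_le (f |B l y|))
        rw [volume_abs_le, volume_abs_le] at this
        exact this
    _ = C * ∫⁻ y, ((2 * Φ (B i y, B l y)) * (2 * f |B l y|)) := lintegral_const_mul' _ _ h.ne_top
    _ ≤ C * (C * ∫⁻ w : ℝ × ℝ, (2 * Φ w) * (2 * f |w.2|)) := by
        gcongr
        exact h.bound₂.lintegral_le hil (g := fun w => (2 * Φ w) * (2 * f |w.2|)) (by fun_prop)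
    _ = C * (C * (4 * ∫⁻ v, (∫⁻ u, Φ (u, v)) * f |v|)) := by
        congr 2
        rw [← lintegral_const_mul' _ _ (by simp), Measure.volume_eq_prod ℝ ℝ,
          lintegral_prod_symm' _ (by fun_prop)]
        refine lintegral_congr fun v => ?_
        rw [← lintegral_mul_const _ (by fun_prop), ← lintegral_const_mul' _ _ (by simp)]
        refine lintegral_congr fun u => ?_
        ring
    _ = _ := by ring

theorem measurableSet_abs_le_abs : MeasurableSet {w : ℝ × ℝ | |w.1| ≤ |w.2|} :=
  measurableSet_le (by fun_prop) (by fun_prop)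

theorem volume_abs_le_real (s : ℝ) : volume {u : ℝ | |u| ≤ s} = ENNReal.ofReal (2 * s) := by
  have : {u : ℝ | |u| ≤ s} = Icc (-s) s := by ext; simp [abs_le]
  rw [this, Real.volume_Icc]
  ring_nf

theorem lintegral_abs_le_const (s : ℝ) (c : ℝ≥0∞) :
    ∫⁻ u, {u : ℝ | |u| ≤ s}.indicator (fun _ => c) u = c * ENNReal.ofReal (2 * s) := by
  rw [lintegral_indicator (measurableSet_le (by fun_prop) (by fun_prop))]
  simp [volume_abs_le_real]

theorem ofReal_div_mul_ofReal {a b c : ℝ} (ha : 0 ≤ a) (hb : 0 < b) :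
    ENNReal.ofReal a / ENNReal.ofReal b * ENNReal.ofReal c = ENNReal.ofReal (a / b * c) := by
  rw [← ENNReal.ofReal_div_of_pos hb, ENNReal.ofReal_mul (by positivity)]

theorem exists_argmin_functional (B : Fin 4 → ℝ × ℝ →ₗ[ℝ] ℝ) (y : ℝ × ℝ) :
    ∃ i, ∀ k, |B i y| ≤ |B k y| := by
  obtain ⟨i, -, hi⟩ := Finset.exists_min_image Finset.univ (fun i => |B i y|)
    Finset.univ_nonempty
  exact ⟨i, fun k => hi k (Finset.mem_univ k)⟩

theorem exists_two_others (i : Fin 4) : ∃ k l : Fin 4, k ≠ i ∧ l ≠ i ∧ k ≠ l := by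
  revert i; decide

theorem profile_le_of_comparable {f : ℝ → ℝ≥0∞} (hf : Antitone f) {κ E s v : ℝ} (hκ : 0 < κ)
    (hE : volume (profileSet f) ≤ ENNReal.ofReal E) (hv : 0 < v) (hs : κ * v ≤ s) :
    f s ≤ ENNReal.ofReal E / ENNReal.ofReal (κ * v) :=
  (hf hs).trans (profile_le_div hf (by positivity) hE)

theorem lintegral_profile_le {f : ℝ → ℝ≥0∞} (hf : Antitone f) {E : ℝ}
    (hE : volume (profileSet f) ≤ ENNReal.ofReal E) : ∫⁻ v, f |v| ≤ ENNReal.ofReal E := by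
  rw [volume_profileSet hf.measurable] at hE
  exact (le_mul_of_one_le_left zero_le (by norm_num)).trans hE

/-- The horizontal bands `a < |y| ≤ b`. -/
def band (a b : ℝ) : Set (ℝ × ℝ) := {p | a < |p.2| ∧ |p.2| ≤ b}

theorem mem_band {a b : ℝ} {p : ℝ × ℝ} : p ∈ band a b ↔ a < |p.2| ∧ |p.2| ≤ b := Iff.rfl

theorem measurableSet_band (a b : ℝ) : MeasurableSet (band a b) := by
  have : band a b = {p | a < |p.2|} ∩ {p | |p.2| ≤ b} := rfl
  rw [this]
  exact (measurableSet_lt (by fun_prop) (by fun_prop)).inter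
    (measurableSet_le (by fun_prop) (by fun_prop))

theorem indicator_le_indicator_const {α β : Type*} {s : Set α} {t : Set β} {g : α → ℝ≥0∞}
    {c : ℝ≥0∞} {a : α} {b : β} (h : a ∈ s → b ∈ t ∧ g a ≤ c) :
    s.indicator g a ≤ t.indicator (fun _ => c) b := by
  by_cases ha : a ∈ s
  · rw [indicator_of_mem ha, indicator_of_mem (h ha).1]
    exact (h ha).2
  · rw [indicator_of_notMem ha]
    exact zero_le

/-- Configurations with second components on both sides of the level `b` are few when the
sets have small mass near that level. -/
theorem Splitting.measure_crossing_le (h : Splitting L A B C) {κ E K b ω : ℝ} (hκ : 0 < κ)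
    (hcomp : ∀ i j k, k ≠ i → ∀ y, |B i y| ≤ |B k y| → κ * |B j y| ≤ |B k y|)
    {f : Fin 4 → ℝ → ℝ≥0∞} (hf : ∀ i, Antitone (f i)) (hE0 : 0 ≤ E)
    (hE : ∀ i, volume (profileSet (f i)) ≤ ENNReal.ofReal E) (hb : 0 < b) (hK : 0 < K)
    (hω : ∀ i, volume (profileSet (f i) ∩ band (κ * b) (K * b)) ≤ ENNReal.ofReal ω) :
    volume {z | z ∈ config L (fun i => profileSet (f i)) ∧ (∃ i, |(L i z).2| ≤ b) ∧
      ∃ i, b < |(L i z).2|} ≤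
      16 * C * C * (ENNReal.ofReal (2 * E / κ) *
        (ENNReal.ofReal ω + ENNReal.ofReal (1 / K) * ENNReal.ofReal E)) := by
  choose k l hk hl hkl using exists_two_others
  -- Here w = (B_i y, B_l y), where i has the least height. The value bounds |A_k x| by the profile
  -- estimate, as the k-th height is at least κ|B_l y|. Straddling b forces |B_i y| ≤ b and |B_l y|
  -- > κb.
  set Φ : ℝ × ℝ → ℝ≥0∞ := {w : ℝ × ℝ | |w.1| ≤ |w.2| ∧ |w.1| ≤ b ∧ κ * b < |w.2|}.indicator
    (fun w => ENNReal.ofReal E / ENNReal.ofReal (κ * |w.2|)) with hΦ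
  have hΦm : Measurable Φ := by
    refine Measurable.indicator (by fun_prop) ?_
    have : {w : ℝ × ℝ | |w.1| ≤ |w.2| ∧ |w.1| ≤ b ∧ κ * b < |w.2|} =
      {w | |w.1| ≤ |w.2|} ∩ ({w | |w.1| ≤ b} ∩ {w | κ * b < |w.2|}) := rfl
    rw [this]
    exact measurableSet_abs_le_abs.inter ((measurableSet_le (by fun_prop) (by fun_prop)).inter
      (measurableSet_lt (by fun_prop) (by fun_prop)))
  have hsub : {z | z ∈ config L (fun i => profileSet (f i)) ∧ (∃ i, |(L i z).2| ≤ b) ∧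
      ∃ i, b < |(L i z).2|} ⊆ ⋃ i, {z : (ℝ × ℝ) × (ℝ × ℝ) |
        ENNReal.ofReal |A (k i) z.1| ≤ Φ (B i z.2, B (l i) z.2) ∧
        ENNReal.ofReal |A (l i) z.1| ≤ f (l i) |B (l i) z.2|} := by
    rintro ⟨x, y⟩ ⟨hz, ⟨m, hm⟩, ⟨M, hM⟩⟩
    simp only [config, mem_ofPred_eq, h.apply, mem_profileSet] at hz hm hM
    obtain ⟨i, hi⟩ := exists_argmin_functional B y
    refine mem_iUnion.2 ⟨i, ?_, hz (l i)⟩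
    have h1 : κ * |B M y| ≤ |B (l i) y| := hcomp i M (l i) (hl i) y (hi _)
    have h2 : κ * b < |B (l i) y| := lt_of_lt_of_le (by gcongr) h1
    have hpos : 0 < |B (l i) y| := lt_trans (by positivity) h2
    have hmem : (B i y, B (l i) y) ∈
        {w : ℝ × ℝ | |w.1| ≤ |w.2| ∧ |w.1| ≤ b ∧ κ * b < |w.2|} := ⟨hi _, (hi m).trans hm, h2⟩
    rw [hΦ, indicator_of_mem hmem]
    exact (hz (k i)).trans (profile_le_of_comparable (hf _) hκ (hE _) hpos
      (hcomp i (l i) (k i) (hk i) y (hi _)))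
  -- For |v| ≤ Kb the constraint |u| ≤ |v| gives 2E/κ, to be paired with the small mass ω of the
  -- band. For larger |v| the constraint |u| ≤ b gains a factor 1/K.
  have hint : ∀ v, ∫⁻ u, Φ (u, v) ≤ ENNReal.ofReal (2 * E / κ) *
      ({v : ℝ | κ * b < |v| ∧ |v| ≤ K * b}.indicator 1 v + ENNReal.ofReal (1 / K)) := by
    intro v
    by_cases hv : κ * b < |v|
    swap
    · have : ∀ u, Φ (u, v) = 0 := fun u => indicator_of_notMem (fun hh => hv hh.2.2) _
      simp [this]
    have hvpos : 0 < |v| := lt_trans (by positivity) hv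
    by_cases hvK : |v| ≤ K * b
    · rw [indicator_of_mem (show v ∈ {v : ℝ | κ * b < |v| ∧ |v| ≤ K * b} from ⟨hv, hvK⟩)]
      calc ∫⁻ u, Φ (u, v) ≤ ∫⁻ u, {u : ℝ | |u| ≤ |v|}.indicator
              (fun _ => ENNReal.ofReal E / ENNReal.ofReal (κ * |v|)) u := by
            refine lintegral_mono fun u => ?_
            exact indicator_le_indicator_const fun hu => ⟨hu.1, le_rfl⟩
        _ = ENNReal.ofReal (2 * E / κ) := by
            rw [lintegral_abs_le_const, ofReal_div_mul_ofReal hE0 (by positivity)]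
            congr 1
            field_simp
        _ ≤ _ := le_mul_of_one_le_right zero_le (by simp)
    · push Not at hvK
      calc ∫⁻ u, Φ (u, v) ≤ ∫⁻ u, {u : ℝ | |u| ≤ b}.indicator
              (fun _ => ENNReal.ofReal E / ENNReal.ofReal (κ * |v|)) u := by
            refine lintegral_mono fun u => ?_
            exact indicator_le_indicator_const fun hu => ⟨hu.2.1, le_rfl⟩
        _ = ENNReal.ofReal (2 * E / κ * (b / |v|)) := by
            rw [lintegral_abs_le_const, ofReal_div_mul_ofReal hE0 (by positivity)]
            congr 1
            field_simp
        _ ≤ ENNReal.ofReal (2 * E / κ * (1 / K)) := by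
            apply ENNReal.ofReal_le_ofReal
            gcongr ?_ * ?_
            rw [div_le_div_iff₀ hvpos hK]
            linarith
        _ ≤ _ := by
            rw [ENNReal.ofReal_mul (by positivity)]
            gcongr
            exact le_add_self
  have hmain : ∀ i, volume {z : (ℝ × ℝ) × (ℝ × ℝ) |
        ENNReal.ofReal |A (k i) z.1| ≤ Φ (B i z.2, B (l i) z.2) ∧
        ENNReal.ofReal |A (l i) z.1| ≤ f (l i) |B (l i) z.2|} ≤
      4 * C * C * (ENNReal.ofReal (2 * E / κ) *
        (ENNReal.ofReal ω + ENNReal.ofReal (1 / K) * ENNReal.ofReal E)) := by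
    intro i
    refine (h.measure_triple_le (hkl i) (hl i).symm (hf _).measurable hΦm).trans ?_
    gcongr
    set I := {v : ℝ | κ * b < |v| ∧ |v| ≤ K * b} with hI
    have hIm : MeasurableSet I := by
      have : I = {v | κ * b < |v|} ∩ {v | |v| ≤ K * b} := rfl
      rw [this]
      exact (measurableSet_lt (by fun_prop) (by fun_prop)).inter
        (measurableSet_le (by fun_prop) (by fun_prop))
    have hfm : Measurable fun v => f (l i) |v| := (hf _).measurable.comp measurable_abs
    calc _ ≤ ∫⁻ v, ENNReal.ofReal (2 * E / κ) * (I.indicator 1 v * f (l i) |v| +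
          ENNReal.ofReal (1 / K) * f (l i) |v|) := by
          refine lintegral_mono fun v => ?_
          refine (mul_le_mul_left (hint v) _).trans_eq ?_
          ring
      _ = ENNReal.ofReal (2 * E / κ) * ((∫⁻ v, I.indicator 1 v * f (l i) |v|) +
          ENNReal.ofReal (1 / K) * ∫⁻ v, f (l i) |v|) := by
          rw [lintegral_const_mul' _ _ (by simp), lintegral_add_right _ (hfm.const_mul _),
            lintegral_const_mul' _ _ (by simp)]
      _ ≤ _ := by
          gcongr
          · refine le_trans ?_ (hω (l i))
            have := volume_profileSet_inter (hf (l i)).measurable hIm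
            refine le_trans ?_ this.ge
            exact le_mul_of_one_le_left zero_le (by norm_num)
          · exact lintegral_profile_le (hf _) (hE _)
  calc _ ≤ _ := measure_mono hsub
    _ ≤ ∑ i, _ := measure_iUnion_fintype_le _ _
    _ ≤ ∑ i : Fin 4, 4 * C * C * (ENNReal.ofReal (2 * E / κ) *
        (ENNReal.ofReal ω + ENNReal.ofReal (1 / K) * ENNReal.ofReal E)) :=
        Finset.sum_le_sum fun i _ => hmain i
    _ = _ := by
        rw [Finset.sum_const, Finset.card_univ, Fintype.card_fin, nsmul_eq_mul]
        push_cast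
        ring

theorem abs_le_div_of_mul_le {a s t ρ : ℝ} (hρ : 0 < ρ) (ht : 0 ≤ t) (hst : t ≤ s)
    (h : |a| * s ≤ ρ) : ENNReal.ofReal |a| ≤ ENNReal.ofReal ρ / ENNReal.ofReal t := by
  rcases ht.eq_or_lt with rfl | ht
  · simp [ENNReal.div_zero, hρ]
  · rw [← ENNReal.ofReal_div_of_pos ht]
    apply ENNReal.ofReal_le_ofReal
    rw [le_div_iff₀ ht]
    exact (mul_le_mul_of_nonneg_left hst (abs_nonneg a)).trans h

theorem Splitting.measure_triple_le_const (h : Splitting L A B C) {i k l : Fin 4} (hkl : k ≠ l)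
    (hil : i ≠ l) {f : ℝ → ℝ≥0∞} (hf : Antitone f) {E M : ℝ}
    (hE : volume (profileSet f) ≤ ENNReal.ofReal E) {Φ : ℝ × ℝ → ℝ≥0∞} (hΦ : Measurable Φ)
    (hM : ∀ v, ∫⁻ u, Φ (u, v) ≤ ENNReal.ofReal M) :
    volume {z : (ℝ × ℝ) × (ℝ × ℝ) | ENNReal.ofReal |A k z.1| ≤ Φ (B i z.2, B l z.2) ∧
      ENNReal.ofReal |A l z.1| ≤ f |B l z.2|} ≤
      4 * C * C * (ENNReal.ofReal M * ENNReal.ofReal E) := by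
  refine (h.measure_triple_le hkl hil hf.measurable hΦ).trans ?_
  gcongr
  calc _ ≤ ∫⁻ v, ENNReal.ofReal M * f |v| := lintegral_mono fun v => by gcongr; exact hM v
    _ = ENNReal.ofReal M * ∫⁻ v, f |v| := lintegral_const_mul' _ _ (by simp)
    _ ≤ _ := by gcongr; exact lintegral_profile_le hf hE

/-- Configurations whose `0`-th point lies in the region `|x y| ≤ ρ`. -/
theorem Splitting.measure_hyperbola_le (h : Splitting L A B C) {κ E ρ τ : ℝ} (hκ : 0 < κ)
    (hcomp : ∀ i j k, k ≠ i → ∀ y, |B i y| ≤ |B k y| → κ * |B j y| ≤ |B k y|)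
    {f : Fin 4 → ℝ → ℝ≥0∞} (hf : ∀ i, Antitone (f i)) (hE0 : 0 < E)
    (hE : ∀ i, volume (profileSet (f i)) ≤ ENNReal.ofReal E) (hρ : 0 < ρ) (hτ : 0 < τ) :
    volume {z | z ∈ config L (fun i => profileSet (f i)) ∧ |(L 0 z).1| * |(L 0 z).2| ≤ ρ} ≤
      32 * C * C * (ENNReal.ofReal (2 * ρ / κ + 2 * τ * E / κ + 2 * ρ / τ) *
        ENNReal.ofReal E) := by
  set M := 2 * ρ / κ + 2 * τ * E / κ + 2 * ρ / τ with hM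
  have hρκ : 0 < 2 * ρ / κ := by positivity
  have hτκ : 0 ≤ 2 * τ * E / κ := by positivity
  have hρτ : 0 < 2 * ρ / τ := by positivity
  have hdiag : ∀ (g : ℝ → ℝ≥0∞), Measurable g →
      Measurable ({w : ℝ × ℝ | |w.1| ≤ |w.2|}.indicator fun w => g |w.2|) := fun g hg =>
    Measurable.indicator (by fun_prop) measurableSet_abs_le_abs
  have key : ∀ i : Fin 4, volume {z | z ∈ config L (fun i => profileSet (f i)) ∧
      |(L 0 z).1| * |(L 0 z).2| ≤ ρ ∧ ∀ k, |B i z.2| ≤ |B k z.2|} ≤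
      8 * C * C * (ENNReal.ofReal M * ENNReal.ofReal E) := by
    intro i
    -- If the 0-th height is the least, it may be tiny and then |xy| ≤ ρ says nothing about |x|. The
    -- cases |B_0 y| ≤ τ|B_l y| (a thin set of u) and |B_0 y| > τ|B_l y| (where |A_0 x| ≤ ρ/(τ|B_l
    -- y|)) are therefore treated apart. If another height is the least, |B_0 y| ≥ κ|B_l y| and no
    -- cut is needed.
    by_cases hi : i = 0
    · subst hi
      obtain ⟨k, l, hk, hl, hkl⟩ := exists_two_others 0
      set Φ₁ : ℝ × ℝ → ℝ≥0∞ := {w : ℝ × ℝ | |w.1| ≤ τ * |w.2|}.indicator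
        (fun w => ENNReal.ofReal E / ENNReal.ofReal (κ * |w.2|)) with hΦ₁
      set Φ₂ : ℝ × ℝ → ℝ≥0∞ := {w : ℝ × ℝ | |w.1| ≤ |w.2|}.indicator
        (fun w => ENNReal.ofReal ρ / ENNReal.ofReal (τ * |w.2|)) with hΦ₂
      have hm₁ : Measurable Φ₁ :=
        Measurable.indicator (by fun_prop) (measurableSet_le (by fun_prop) (by fun_prop))
      have hm₂ : Measurable Φ₂ :=
        hdiag (fun t => ENNReal.ofReal ρ / ENNReal.ofReal (τ * t)) (by fun_prop)
      have b₁ := h.measure_triple_le_const hkl hl.symm (hf l) (hE l) hm₁ (M := M) (by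
        intro v
        rcases (abs_nonneg v).eq_or_lt with hv | hv
        -- At v = 0 the quotient is infinite, but only on the null set u = 0.
        · refine le_of_eq_of_le (lintegral_eq_zero_of_ae_eq_zero ?_) zero_le
          have h0 : ∀ᵐ u : ℝ, u ≠ 0 := by simp [ae_iff]
          filter_upwards [h0] with u hu
          refine indicator_of_notMem (fun hu' => hu ?_) _
          have hu'' : |u| ≤ τ * |v| := hu'
          rw [← hv, mul_zero] at hu''
          exact abs_nonpos_iff.1 hu''
        calc ∫⁻ u, Φ₁ (u, v) ≤ ∫⁻ u, {u : ℝ | |u| ≤ τ * |v|}.indicator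
                (fun _ => ENNReal.ofReal E / ENNReal.ofReal (κ * |v|)) u :=
              lintegral_mono fun u => indicator_le_indicator_const fun hu => ⟨hu, le_rfl⟩
          _ ≤ ENNReal.ofReal M := by
              rw [lintegral_abs_le_const, ofReal_div_mul_ofReal hE0.le (by positivity)]
              apply ENNReal.ofReal_le_ofReal
              have e1 : E / (κ * |v|) * (2 * (τ * |v|)) = 2 * τ * E / κ := by field_simp
              rw [e1, hM]; linarith)
      have b₂ := h.measure_triple_le_const hl.symm hl.symm (hf l) (hE l) hm₂ (M := M) (by
        intro v
        calc ∫⁻ u, Φ₂ (u, v) ≤ ∫⁻ u, {u : ℝ | |u| ≤ |v|}.indicator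
                (fun _ => ENNReal.ofReal ρ / ENNReal.ofReal (τ * |v|)) u :=
              lintegral_mono fun u => indicator_le_indicator_const fun hu => ⟨hu, le_rfl⟩
          _ ≤ ENNReal.ofReal M := by
              rw [lintegral_abs_le_const]
              rcases (abs_nonneg v).eq_or_lt with hv | hv
              · simp [← hv]
              rw [ofReal_div_mul_ofReal hρ.le (by positivity)]
              apply ENNReal.ofReal_le_ofReal
              have e2 : ρ / (τ * |v|) * (2 * |v|) = 2 * ρ / τ := by field_simp
              rw [e2, hM]; linarith)
      refine le_trans ((measure_mono ?_).trans (measure_union_le _ _)) ((add_le_add b₁ b₂).trans_eq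
        (by ring))
      rintro ⟨x, y⟩ ⟨hz, hzρ, hmin⟩
      simp only [config, mem_ofPred_eq, h.apply, mem_profileSet] at hz hzρ hmin
      rcases le_or_gt |B 0 y| (τ * |B l y|) with hu | hu
      · refine Or.inl ⟨?_, hz l⟩
        rw [hΦ₁, indicator_of_mem (by exact hu)]
        rcases (abs_nonneg (B l y)).eq_or_lt with hv | hv
        · dsimp only
          rw [← hv, mul_zero, ENNReal.ofReal_zero]
          rw [ENNReal.div_zero (by simpa using hE0)]
          exact le_top
        · exact (hz k).trans (profile_le_of_comparable (hf _) hκ (hE _) hv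
            (hcomp 0 l k hk y (hmin _)))
      · refine Or.inr ⟨?_, hz l⟩
        rw [hΦ₂, indicator_of_mem (by exact hmin l)]
        exact abs_le_div_of_mul_le hρ (by positivity) hu.le hzρ
    · obtain ⟨l, hl0, hli⟩ : ∃ l : Fin 4, 0 ≠ l ∧ i ≠ l := by
        clear * -; revert i; decide
      set Φ : ℝ × ℝ → ℝ≥0∞ := {w : ℝ × ℝ | |w.1| ≤ |w.2|}.indicator
        (fun w => ENNReal.ofReal ρ / ENNReal.ofReal (κ * |w.2|)) with hΦ
      have hΦm : Measurable Φ :=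
        hdiag (fun t => ENNReal.ofReal ρ / ENNReal.ofReal (κ * t)) (by fun_prop)
      refine le_trans (measure_mono ?_) ((h.measure_triple_le_const hl0 hli (hf l) (hE l) hΦm
        (M := M) ?_).trans (by gcongr; norm_num))
      · rintro ⟨x, y⟩ ⟨hz, hzρ, hmin⟩
        simp only [config, mem_ofPred_eq, h.apply, mem_profileSet] at hz hzρ hmin ⊢
        refine ⟨?_, hz l⟩
        rw [hΦ, indicator_of_mem (by exact hmin l)]
        exact abs_le_div_of_mul_le hρ (by positivity) (hcomp i l 0 (Ne.symm hi) y (hmin 0)) hzρ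
      · intro v
        calc ∫⁻ u, Φ (u, v) ≤ ∫⁻ u, {u : ℝ | |u| ≤ |v|}.indicator
                (fun _ => ENNReal.ofReal ρ / ENNReal.ofReal (κ * |v|)) u := by
              refine lintegral_mono fun u => ?_
              exact indicator_le_indicator_const fun hu => ⟨hu, le_rfl⟩
          _ ≤ ENNReal.ofReal M := by
              rw [lintegral_abs_le_const]
              rcases (abs_nonneg v).eq_or_lt with hv | hv
              · simp [← hv]
              rw [ofReal_div_mul_ofReal hρ.le (by positivity)]
              apply ENNReal.ofReal_le_ofReal
              have : ρ / (κ * |v|) * (2 * |v|) = 2 * ρ / κ := by field_simp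
              rw [this, hM]; linarith
  calc _ ≤ _ := measure_mono (t := ⋃ i : Fin 4, {z | z ∈ config L (fun i => profileSet (f i)) ∧
      |(L 0 z).1| * |(L 0 z).2| ≤ ρ ∧ ∀ k, |B i z.2| ≤ |B k z.2|}) ?_
    _ ≤ ∑ i, _ := measure_iUnion_fintype_le _ _
    _ ≤ ∑ i : Fin 4, 8 * C * C * (ENNReal.ofReal M * ENNReal.ofReal E) :=
        Finset.sum_le_sum fun i _ => key i
    _ = _ := by
        rw [Finset.sum_const, Finset.card_univ, Fintype.card_fin, nsmul_eq_mul]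
        push_cast
        ring
  intro z hz
  obtain ⟨i, hi⟩ := exists_argmin_functional B z.2
  exact mem_iUnion.2 ⟨i, hz.1, hz.2, hi⟩

theorem Splitting.exists_hyperbola_bound (h : Splitting L A B C) {E : ℝ} (hE0 : 0 < E)
    {γ : ℝ≥0∞} (hγ : 0 < γ) : ∃ ρ : ℝ, 0 < ρ ∧ ∀ f : Fin 4 → ℝ → ℝ≥0∞, (∀ i, Antitone (f i)) →
      (∀ i, volume (profileSet (f i)) ≤ ENNReal.ofReal E) →
      volume {z | z ∈ config L (fun i => profileSet (f i)) ∧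
        |(L 0 z).1| * |(L 0 z).2| ≤ ρ} ≤ γ := by
  obtain ⟨κ, hκ, -, hcomp⟩ := exists_comparable h.bij₂
  have hlim : Tendsto (fun τ : ℝ => 32 * C * C * (ENNReal.ofReal
      (2 * τ ^ 2 / κ + 2 * τ * E / κ + 2 * τ) * ENNReal.ofReal E)) (𝓝[>] 0) (𝓝 0) := by
    have h1 : Tendsto (fun τ : ℝ => 2 * τ ^ 2 / κ + 2 * τ * E / κ + 2 * τ) (𝓝[>] 0) (𝓝 0) := by
      have : Continuous (fun τ : ℝ => 2 * τ ^ 2 / κ + 2 * τ * E / κ + 2 * τ) := by fun_prop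
      have := this.tendsto 0
      simp only [ne_eq, OfNat.ofNat_ne_zero, not_false_eq_true, zero_pow, mul_zero, zero_div,
        zero_mul, add_zero] at this
      exact this.mono_left nhdsWithin_le_nhds
    have h2 := ENNReal.Tendsto.mul_const (b := ENNReal.ofReal E) (ENNReal.tendsto_ofReal h1)
      (Or.inr (by simp))
    have h3 := ENNReal.Tendsto.const_mul (a := 32 * C * C) h2 (Or.inr
      (ENNReal.mul_ne_top (ENNReal.mul_ne_top (by simp) h.ne_top) h.ne_top))
    simpa using h3
  obtain ⟨τ, hτγ, hτ⟩ := ((hlim.eventually (eventually_le_nhds hγ)).and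
    self_mem_nhdsWithin).exists
  have hτ0 : 0 < τ := hτ
  -- With ρ = τ², the term 2ρ/τ equals 2τ, so all three terms vanish as τ → 0.
  refine ⟨τ ^ 2, by positivity, fun f hf hE => ?_⟩
  refine (h.measure_hyperbola_le hκ hcomp hf hE0 hE (by positivity) hτ0).trans ?_
  convert hτγ using 5
  field_simp

/-! ### Dilation and translation invariance; placing two tuples side by side -/

/-- V = ℝ gives D_t on the plane, and V = ℝ² gives the dilation of ℝ⁴ that the maps L_i intertwine
with D_t. -/
theorem measurePreserving_smul_inv_smul {V : Type*} [NormedAddCommGroup V] [NormedSpace ℝ V]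
    [FiniteDimensional ℝ V] [MeasureSpace V] [BorelSpace V]
    [(volume : Measure V).IsAddHaarMeasure] {t : ℝ} (ht : t ≠ 0) :
    MeasurePreserving (fun p : V × V => (t • p.1, t⁻¹ • p.2)) := by
  refine ⟨by fun_prop, ?_⟩
  have hdet : LinearMap.det ((t • LinearMap.id : V →ₗ[ℝ] V).prodMap
      (t⁻¹ • LinearMap.id : V →ₗ[ℝ] V)) = 1 := by
    rw [LinearMap.det_prodMap, LinearMap.det_smul, LinearMap.det_smul, LinearMap.det_id, mul_one,
      mul_one, ← mul_pow, mul_inv_cancel₀ ht, one_pow]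
  have : (volume : Measure (V × V)).IsAddHaarMeasure := by
    rw [Measure.volume_eq_prod]; infer_instance
  have hmap := Measure.map_linearMap_addHaar_eq_smul_addHaar (volume : Measure (V × V))
    (hdet.trans_ne one_ne_zero)
  rw [hdet] at hmap
  simp only [inv_one, abs_one, ENNReal.ofReal_one, one_smul] at hmap
  exact hmap

theorem measurePreserving_dilation {t : ℝ} (ht : t ≠ 0) : MeasurePreserving (dilation t) :=
  measurePreserving_smul_inv_smul ht

theorem Splitting.map_dilation (h : Splitting L A B C) (i : Fin 4) (t : ℝ)
    (z : (ℝ × ℝ) × (ℝ × ℝ)) : L i (t • z.1, t⁻¹ • z.2) = dilation t (L i z) := by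
  obtain ⟨x, y⟩ := z
  simp [h.apply, dilation]

theorem Splitting.Lam_preimage_dilation (h : Splitting L A B C) {E : Fin 4 → Set (ℝ × ℝ)}
    (hE : ∀ i, MeasurableSet (E i)) {t : ℝ} (ht : t ≠ 0) :
    Lam L (fun i => dilation t ⁻¹' E i) = Lam L E := by
  rw [Lam_eq L hE, Lam_eq L fun i => (measurePreserving_dilation ht).measurable (hE i)]
  rw [← (measurePreserving_smul_inv_smul (V := ℝ × ℝ) ht).measure_preimage
    (measurableSet_config L hE).nullMeasurableSet]
  congr 1
  ext z
  simp only [config, mem_ofPred_eq, mem_preimage, h.map_dilation]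

theorem volume_preimage_sub (v : ℝ × ℝ) (S : Set (ℝ × ℝ)) :
    volume ((fun p => p - v) ⁻¹' S) = volume S := by
  simp only [sub_eq_add_neg]
  exact measure_preimage_add_right volume (-v) S

theorem Lam_preimage_sub (L : MapTuple) {E : Fin 4 → Set (ℝ × ℝ)}
    (hE : ∀ i, MeasurableSet (E i)) (w : (ℝ × ℝ) × (ℝ × ℝ)) :
    Lam L (fun i => (fun p => p - L i w) ⁻¹' E i) = Lam L E := by
  rw [Lam_eq L hE, Lam_eq L fun i => (measurable_sub_const _) (hE i)]
  have : (volume : Measure ((ℝ × ℝ) × (ℝ × ℝ))).IsAddHaarMeasure := by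
    rw [Measure.volume_eq_prod]; infer_instance
  rw [← measure_preimage_add_right volume (-w) (config L E)]
  congr 1
  ext z
  simp [config, sub_eq_add_neg]

theorem tendsto_volume_diff_strip {V : Set (ℝ × ℝ)} (hV : MeasurableSet V)
    (hfin : volume V ≠ ∞) : Tendsto (fun n : ℕ => volume (V \ strip n)) atTop (𝓝 0) := by
  have hanti : Antitone fun n : ℕ => V \ strip n := fun n m hnm =>
    sdiff_subset_sdiff_right (strip_mono (by exact_mod_cast hnm))
  have := tendsto_measure_iInter_atTop (μ := volume)
    (fun n : ℕ => (hV.diff (measurableSet_strip n)).nullMeasurableSet) hanti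
    ⟨0, ne_top_of_le_ne_top hfin (measure_mono sdiff_subset)⟩
  have hempty : ⋂ n : ℕ, V \ strip n = ∅ := by
    refine eq_empty_of_forall_notMem fun p hp => ?_
    obtain ⟨n, hn⟩ := exists_nat_ge |p.2|
    exact (mem_iInter.1 hp n).2 hn
  rwa [hempty, measure_empty] at this

/-- Two tuples can be placed side by side, overlapping only in their `0`-th sets. -/
theorem Splitting.Lam_add_le_Theta (h : Splitting L A B C) {N G : Fin 4 → Set (ℝ × ℝ)}
    (hN : ∀ i, MeasurableSet (N i)) (hG : ∀ i, MeasurableSet (G i)) {b : ℝ}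
    (hb : N 1 ⊆ strip b) {e : Fin 4 → ℝ}
    (he : ∀ i, i ≠ 0 → volume (N i) + volume (G i) ≤ ENNReal.ofReal (e i))
    (he0 : volume (N 0 ∪ G 0) ≤ ENNReal.ofReal (e 0)) : Lam L N + Lam L G ≤ Theta L e := by
  -- Translating along (0, y) fixes the 0-th set and moves the first set vertically.
  obtain ⟨y, hy⟩ := (h.bij₂ 0 1 (by decide)).2 ((0 : ℝ), (1 : ℝ))
  have hy0 : B 0 y = 0 := congrArg Prod.fst hy
  have hy1 : B 1 y = 1 := congrArg Prod.snd hy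
  have hG1 : volume (G 1) ≠ ∞ :=
    ne_top_of_le_ne_top ENNReal.ofReal_ne_top (le_add_self.trans (he 1 (by decide)))
  have hN2 : volume (N 2) ≠ ∞ :=
    ne_top_of_le_ne_top ENNReal.ofReal_ne_top (le_self_add.trans (he 2 (by decide)))
  have hbound : ∀ n : ℕ, Lam L N + Lam L G ≤
      Theta L e + C * C * (volume (G 1 \ strip n) * volume (N 2)) := by
    intro n
    -- The shift n + b + 1 clears the strip |y| ≤ b containing N_1, so only the part of G_1 outside
    -- |y| ≤ n can still meet N_1. That part tends to 0 as n → ∞.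
    set w : (ℝ × ℝ) × (ℝ × ℝ) := (0, (n + b + 1) • y) with hw
    set G' : Fin 4 → Set (ℝ × ℝ) := fun i => (fun p => p - L i w) ⁻¹' G i with hG'
    have hG'm : ∀ i, MeasurableSet (G' i) := fun i => (measurable_sub_const _) (hG i)
    have hG'v : ∀ i, volume (G' i) = volume (G i) := fun i =>
      volume_preimage_sub _ _
    have hL0 : L 0 w = 0 := by simp [hw, h.apply, hy0]
    have hL1 : L 1 w = (0, n + b + 1) := by simp [hw, h.apply, hy1]
    have hG0 : G' 0 = G 0 := by simp [hG', hL0]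
    have hU : Lam L (fun i => N i ∪ G' i) ≤ Theta L e := by
      refine Lam_le_Theta L fun i => ?_
      by_cases hi : i = 0
      · subst hi
        rwa [hG0]
      · exact (measure_union_le _ _).trans (by rw [hG'v]; exact he i hi)
    have hinter : volume (config L N ∩ config L G') ≤
        C * C * (volume (G 1 \ strip n) * volume (N 2)) := by
      have h1 : volume (N 1 ∩ G' 1) ≤ volume (G 1 \ strip n) := by
        rw [← volume_preimage_sub (L 1 w) (G 1 \ strip n)]
        refine measure_mono fun p hp => ⟨hp.2, fun hp' => ?_⟩
        have h2 : |p.2| ≤ b := hb hp.1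
        have h3 : |(p - L 1 w).2| ≤ n := hp'
        rw [hL1] at h3
        simp only [Prod.snd_sub] at h3
        have := (abs_le.1 h2).2
        have := (abs_le.1 h3).1
        linarith
      calc _ ≤ volume {z | L 1 z ∈ N 1 ∩ G' 1 ∧ L 2 z ∈ N 2} :=
            measure_mono fun z hz => ⟨⟨hz.1 1, hz.2 1⟩, hz.1 2⟩
        _ ≤ _ := h.measure_pair_le (by decide) _ _
        _ ≤ _ := by gcongr
    rw [← Lam_preimage_sub L hG w, Lam_eq L hN, Lam_eq L hG'm,
      ← measure_union_add_inter _ (measurableSet_config L hG'm)]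
    refine add_le_add (le_trans ?_ hU) hinter
    rw [Lam_eq L fun i => (hN i).union (hG'm i)]
    refine measure_mono ?_
    rintro z (hz | hz) i
    · exact Or.inl (hz i)
    · exact Or.inr (hz i)
  have hlim : Tendsto (fun n : ℕ => Theta L e + C * C * (volume (G 1 \ strip n) * volume (N 2)))
      atTop (𝓝 (Theta L e)) := by
    have h1 := ENNReal.Tendsto.mul_const (b := volume (N 2)) (tendsto_volume_diff_strip (hG 1) hG1)
      (Or.inr hN2)
    have h2 := ENNReal.Tendsto.const_mul (a := C * C) h1
      (Or.inr (ENNReal.mul_ne_top h.ne_top h.ne_top))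
    simpa using h2.const_add (Theta L e)
  exact ge_of_tendsto' hlim hbound

theorem box_subset_profileSet {f : ℝ → ℝ≥0∞} (hf : Antitone f) {s ρ : ℝ} {p : ℝ × ℝ}
    (hp : p ∈ profileSet f) (hs : |p.2| = s) (hs0 : 0 < s) (hρ : ρ < |p.1| * |p.2|)
    {q : ℝ × ℝ} (hq₁ : q.1 ∈ Icc (-(ρ / s)) (ρ / s)) (hq₂ : |q.2| ≤ s) : q ∈ profileSet f := by
  rw [mem_profileSet] at hp ⊢
  refine le_trans (ENNReal.ofReal_le_ofReal ?_) (hp.trans (hf (hs ▸ hq₂)))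
  refine (abs_le.2 hq₁).trans ?_
  rw [div_le_iff₀ hs0, ← hs]
  exact hρ.le

/-! ### The dichotomy at a level with little mass nearby -/

/-- A near-maximizing tuple of profile sets with little mass near the level `b` has almost all
of its mass on one side of that level. -/
theorem Splitting.dichotomy (h : Splitting L A B C) {e : Fin 4 → ℝ} (he : ∀ i, 0 < e i)
    (hadm : Admissible L e) {ε : ℝ} (hε : 0 < ε) (hεe : ∀ i, ε < e i) :
    ∃ ω κ K : ℝ, 0 < ω ∧ 0 < κ ∧ κ ≤ 1 / 2 ∧ 1 ≤ K ∧ ∀ f : Fin 4 → ℝ → ℝ≥0∞,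
      (∀ i, Antitone (f i)) → (∀ i, volume (profileSet (f i)) = ENNReal.ofReal (e i)) →
      Theta L e ≤ Lam L (fun i => profileSet (f i)) + ENNReal.ofReal ω →
      ∀ b, 0 < b →
      (∀ i, volume (profileSet (f i) ∩ band (κ * b) (K * b)) ≤ ENNReal.ofReal ω) →
      (∀ i, volume (profileSet (f i) ∩ strip b) ≤ ENNReal.ofReal ε) ∨
      (∀ i, volume (profileSet (f i) \ strip b) ≤ ENNReal.ofReal ε) := by
  obtain ⟨κ, hκ, hκ2, hcomp⟩ := exists_comparable h.bij₂
  set E : ℝ := ∑ i, e i with hE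
  have hE0 : 0 < E := Finset.sum_pos (fun i _ => he i) Finset.univ_nonempty
  have heE : ∀ i, e i ≤ E := fun i =>
    Finset.single_le_sum (fun i _ => (he i).le) (Finset.mem_univ i)
  -- The constants are chosen in the order γ (loss when any set shrinks by ε), ρ (hyperbolic region
  -- contributing at most γ/2), γ' (loss when the 0-th set shrinks by δ ≤ ρ), and finally ω, so
  -- small that the total error is below both γ/2 and γ'.
  obtain ⟨γ, hγ0, hγ⟩ : ∃ γ : ℝ≥0∞, 0 < γ ∧
      ∀ j, Theta L (Function.update e j (e j - ε)) + γ ≤ Theta L e := by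
    choose g hg0 hgt hg using fun j => hadm.exists_gap he h j hε (hεe j)
    obtain ⟨j, -, hj⟩ := Finset.exists_min_image Finset.univ g Finset.univ_nonempty
    exact ⟨g j, hg0 j, fun k => (add_le_add le_rfl (hj k (Finset.mem_univ k))).trans (hg k)⟩
  have hγ2 : 0 < γ / 2 := ENNReal.half_pos hγ0.ne'
  obtain ⟨ρ, hρ, hhyp⟩ := h.exists_hyperbola_bound hE0 hγ2
  set δ : ℝ := min ρ (e 0 / 2) with hδ
  have hδ0 : 0 < δ := lt_min hρ (half_pos (he 0))
  have hδe : δ < e 0 := (min_le_right _ _).trans_lt (half_lt_self (he 0))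
  obtain ⟨γ', hγ'0, -, hγ'⟩ := hadm.exists_gap he h 0 hδ0 hδe
  obtain ⟨ω, hω0, hω1, hωρ, hωγ⟩ : ∃ ω : ℝ, 0 < ω ∧ ω < 1 ∧ ω < ρ / 2 ∧
      16 * C * C * (ENNReal.ofReal (2 * E / κ) * (ENNReal.ofReal ω +
        ENNReal.ofReal (1 / (1 / ω)) * ENNReal.ofReal E)) + ENNReal.ofReal ω <
        min (γ / 2) γ' := by
    have hlim : Tendsto (fun ω : ℝ => 16 * C * C * (ENNReal.ofReal (2 * E / κ) *
        (ENNReal.ofReal ω + ENNReal.ofReal ω * ENNReal.ofReal E)) + ENNReal.ofReal ω)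
        (𝓝[>] 0) (𝓝 0) := by
      have h0 : Tendsto (fun ω : ℝ => ENNReal.ofReal ω) (𝓝[>] 0) (𝓝 0) := by
        have := ENNReal.tendsto_ofReal (tendsto_id.mono_left
          (nhdsWithin_le_nhds (a := (0 : ℝ)) (s := Ioi 0)))
        simpa using this
      have h1 := ENNReal.Tendsto.mul_const (b := ENNReal.ofReal E) h0 (Or.inr (by simp))
      have h2 := ENNReal.Tendsto.const_mul (a := ENNReal.ofReal (2 * E / κ)) (h0.add h1)
        (Or.inr (by simp))
      have h3 := ENNReal.Tendsto.const_mul (a := 16 * C * C) h2 (Or.inr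
        (ENNReal.mul_ne_top (ENNReal.mul_ne_top (by simp) h.ne_top) h.ne_top))
      simpa using h3.add h0
    have hpos : (0 : ℝ≥0∞) < min (γ / 2) γ' := lt_min hγ2 hγ'0
    have e1 : ∀ᶠ x in 𝓝[>] (0 : ℝ), x ∈ Ioo 0 1 := Ioo_mem_nhdsGT one_pos
    have e2 : ∀ᶠ x in 𝓝[>] (0 : ℝ), x ∈ Ioo 0 (ρ / 2) := Ioo_mem_nhdsGT (half_pos hρ)
    obtain ⟨ω, h1, h3, h4⟩ :=
      ((hlim.eventually (eventually_lt_nhds hpos)).and (e1.and e2)).exists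
    exact ⟨ω, h3.1, h3.2, h4.2, by rwa [one_div_one_div]⟩
  refine ⟨ω, κ, 1 / ω, hω0, hκ, hκ2, by rw [le_div_iff₀ hω0]; linarith, ?_⟩
  intro f hf hfe hmax b hb hband
  by_contra hcon
  push Not at hcon
  obtain ⟨⟨i, hi⟩, ⟨j, hj⟩⟩ := hcon
  set N : Fin 4 → Set (ℝ × ℝ) := fun i => profileSet (f i) ∩ strip b with hN
  set G : Fin 4 → Set (ℝ × ℝ) := fun i => profileSet (f i) \ strip b with hG
  have hSm : ∀ i, MeasurableSet (profileSet (f i)) := fun i =>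
    measurableSet_profileSet (hf i).measurable
  have hNm : ∀ i, MeasurableSet (N i) := fun i => (hSm i).inter (measurableSet_strip b)
  have hGm : ∀ i, MeasurableSet (G i) := fun i => (hSm i).diff (measurableSet_strip b)
  have hNG : ∀ i, volume (N i) + volume (G i) = ENNReal.ofReal (e i) := fun i => by
    rw [← hfe i]; exact measure_inter_add_sdiff _ (measurableSet_strip b)
  have hfE : ∀ i, volume (profileSet (f i)) ≤ ENNReal.ofReal E := fun i =>
    (hfe i).trans_le (ENNReal.ofReal_le_ofReal (heE i))
  have hfinN : Lam L N ≠ ∞ := ne_top_of_le_ne_top (h.Theta_ne_top e)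
    (Lam_le_Theta L fun i => le_self_add.trans (hNG i).le)
  have hfinG : Lam L G ≠ ∞ := ne_top_of_le_ne_top (h.Theta_ne_top e)
    (Lam_le_Theta L fun i => le_add_self.trans (hNG i).le)
  obtain ⟨c, hc, hΘ⟩ : ∃ c, c < min (γ / 2) γ' ∧ Theta L e ≤ Lam L N + Lam L G + c := by
    refine ⟨_, hωγ, hmax.trans ?_⟩
    rw [← add_assoc]
    gcongr
    refine le_trans ?_ (add_le_add le_rfl (h.measure_crossing_le hκ hcomp hf hE0.le hfE hb
      (by positivity : 0 < 1 / ω) hband))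
    rw [Lam_eq L hSm, Lam_eq L hNm, Lam_eq L hGm]
    refine le_trans (measure_mono ?_) ((measure_union_le _ _).trans
      (add_le_add (measure_union_le _ _) le_rfl))
    intro z hz
    by_cases h1 : ∃ i, |(L i z).2| ≤ b
    · by_cases h2 : ∃ i, b < |(L i z).2|
      · exact Or.inr ⟨hz, h1, h2⟩
      · push Not at h2
        exact Or.inl (Or.inl fun i => ⟨hz i, h2 i⟩)
    · push Not at h1
      exact Or.inl (Or.inr fun i => ⟨hz i, fun h' => (h1 i).not_ge h'⟩)
  have hc1 : c < γ / 2 := hc.trans_le (min_le_left _ _)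
  have hc2 : c < γ' := hc.trans_le (min_le_right _ _)
  -- If one half contributed at most γ/2, the other would exceed Θ(e) - γ although one of its sets
  -- has lost measure ε.
  have hremain : ∀ (X Y : ℝ≥0∞) (M : Fin 4 → Set (ℝ × ℝ)) (k : Fin 4), X ≤ γ / 2 → Y ≠ ∞ →
      Theta L e ≤ X + Y + c → Y = Lam L M → (∀ i, volume (M i) ≤ ENNReal.ofReal (e i)) →
      volume (M k) ≤ ENNReal.ofReal (e k - ε) → False := by
    intro X Y M k hX hY hXY hYM hM hMk
    have h1 : Y ≤ Theta L (Function.update e k (e k - ε)) := by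
      rw [hYM]
      refine Lam_le_Theta L fun i => ?_
      rcases eq_or_ne i k with rfl | hik
      · simpa using hMk
      · simpa [hik] using hM i
    have h2 := (hγ k).trans hXY
    have h3 : Y + γ < Y + γ := by
      calc Y + γ ≤ X + Y + c := le_trans (by gcongr) h2
        _ ≤ γ / 2 + Y + c := by gcongr
        _ < γ / 2 + Y + γ / 2 := by
            refine ENNReal.add_lt_add_left ?_ hc1
            refine ENNReal.add_ne_top.2 ⟨?_, hY⟩
            intro htop
            have : γ = ∞ := by
              by_contra hne
              exact (ENNReal.div_lt_top hne (by norm_num)).ne htop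
            have hγ0' := hγ 0
            rw [this, add_top] at hγ0'
            exact h.Theta_ne_top e (top_le_iff.1 hγ0')
        _ = Y + γ := by
            rw [add_comm (γ / 2) Y, add_assoc, ENNReal.add_halves]
    exact lt_irrefl _ h3
  have hsplit : ∀ k, ∀ a a' : ℝ≥0∞, a + a' = ENNReal.ofReal (e k) → ENNReal.ofReal ε < a →
      a' ≤ ENNReal.ofReal (e k - ε) := by
    intro k a a' haa ha
    have ha' : a' ≠ ∞ := ne_top_of_le_ne_top ENNReal.ofReal_ne_top (le_add_self.trans haa.le)
    rw [ENNReal.ofReal_sub _ hε.le]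
    refine ENNReal.le_sub_of_add_le_left ENNReal.ofReal_ne_top ?_
    rw [← haa]
    gcongr
  obtain ⟨p, hpN, hp⟩ : ∃ p ∈ N 0, ρ < |p.1| * |p.2| := by
    by_contra hcon
    push Not at hcon
    refine hremain (Lam L N) (Lam L G) G i ?_ hfinG hΘ rfl
      (fun i => le_add_self.trans (hNG i).le) (hsplit i _ _ (hNG i) hi)
    rw [Lam_eq L hNm]
    refine le_trans (measure_mono ?_) (hhyp f hf hfE)
    exact fun z (hz : ∀ i, L i z ∈ _) => ⟨fun i => (hz i).1, hcon _ (hz 0)⟩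
  obtain ⟨q, hqG, hq⟩ : ∃ p ∈ G 0, ρ < |p.1| * |p.2| := by
    by_contra hcon
    push Not at hcon
    refine hremain (Lam L G) (Lam L N) N j ?_ hfinN (by rwa [add_comm (Lam L G)]) rfl
      (fun i => le_self_add.trans (hNG i).le)
      (hsplit j _ _ ((add_comm _ _).trans (hNG j)) hj)
    rw [Lam_eq L hGm]
    refine le_trans (measure_mono ?_) (hhyp f hf hfE)
    exact fun z (hz : ∀ i, L i z ∈ _) => ⟨fun i => (hz i).1, hcon _ (hz 0)⟩
  set t := |p.2| with ht
  set s := |q.2| with hs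
  have ht0 : 0 < t := by
    rcases (abs_nonneg p.2).eq_or_lt with h' | h'
    · rw [ht, ← h', mul_zero] at hp; linarith
    · exact h'
  have htb : t ≤ b := hpN.2
  have hsb : b < s := not_le.1 hqG.2
  have hs0 : 0 < s := hb.trans hsb
  -- Otherwise the box under q at heights between b/2 and b would put area ρb/s > ρ/2 > ω into the
  -- sparse band.
  have hs2 : 2 * b ≤ s := by
    by_contra hlt
    push Not at hlt
    have hsub : {x : ℝ × ℝ | x.1 ∈ Icc (-(ρ / s)) (ρ / s) ∧ x.2 ∈ Ioc (b / 2) b} ⊆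
        profileSet (f 0) ∩ band (κ * b) (1 / ω * b) := by
      rintro x ⟨hx1, hx2⟩
      have hx0 : 0 < x.2 := (half_pos hb).trans hx2.1
      refine ⟨box_subset_profileSet (hf 0) hqG.1 hs.symm hs0 hq hx1 ?_, ?_⟩
      · rw [abs_of_pos hx0]; exact hx2.2.trans hsb.le
      · rw [mem_band, abs_of_pos hx0]
        constructor
        · nlinarith [hx2.1]
        · refine hx2.2.trans (le_mul_of_one_le_left hb.le ?_)
          rw [le_div_iff₀ hω0]; linarith
    have := (measure_mono hsub).trans (hband 0)
    rw [volume_box, ← ENNReal.ofReal_mul (by rw [sub_neg_eq_add]; positivity),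
      ENNReal.ofReal_le_ofReal_iff hω0.le] at this
    have h1 : (ρ / s - -(ρ / s)) * (b - b / 2) = ρ * (b / s) := by ring
    have h2 : 1 / 2 < b / s := by rw [div_lt_div_iff₀ (by norm_num) hs0]; linarith
    rw [h1] at this
    nlinarith
  -- This factor matches height t in the dilated upper set with height s in the original one.
  -- Heights in (t/2, t] then correspond to (s/2, s], which lies above b because s ≥ 2b.
  set σ : ℝ := t / s with hσ
  have hσ0 : 0 < σ := by positivity
  set G' : Fin 4 → Set (ℝ × ℝ) := fun i => dilation σ ⁻¹' G i with hG'
  have hG'm : ∀ i, MeasurableSet (G' i) := fun i =>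
    (measurePreserving_dilation hσ0.ne').measurable (hGm i)
  have hG'v : ∀ i, volume (G' i) = volume (G i) := fun i =>
    (measurePreserving_dilation hσ0.ne').measure_preimage (hGm i).nullMeasurableSet
  have hoverlap : ENNReal.ofReal δ ≤ volume (N 0 ∩ G' 0) := by
    have hsub : {x : ℝ × ℝ | x.1 ∈ Icc (-(ρ / t)) (ρ / t) ∧ x.2 ∈ Ioc (t / 2) t} ⊆
        N 0 ∩ G' 0 := by
      rintro x ⟨hx1, hx2⟩
      have hx0 : 0 < x.2 := (half_pos ht0).trans hx2.1
      have hxt : |x.2| ≤ t := by rw [abs_of_pos hx0]; exact hx2.2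
      have hy0 : 0 < (dilation σ x).2 := by simp only [dilation]; positivity
      have hy1 : |(dilation σ x).2| = s / t * x.2 := by
        rw [abs_of_pos hy0]; simp [dilation, hσ]
      refine ⟨⟨box_subset_profileSet (hf 0) hpN.1 ht.symm ht0 hp hx1 hxt, hxt.trans htb⟩,
        box_subset_profileSet (hf 0) hqG.1 hs.symm hs0 hq ?_ ?_, ?_⟩
      · have e1 : ρ / s = σ * (ρ / t) := by rw [hσ]; field_simp
        rw [mem_Icc, e1]
        simp only [dilation]
        constructor
        · nlinarith [hx1.1]
        · nlinarith [hx1.2]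
      · rw [hy1]
        calc s / t * x.2 ≤ s / t * t := by gcongr; exact hx2.2
          _ = s := by field_simp
      · rw [mem_strip, hy1, not_le]
        calc b ≤ s / t * (t / 2) := by
              have : s / t * (t / 2) = s / 2 := by field_simp
              linarith
          _ < s / t * x.2 := by gcongr; exact hx2.1
    refine le_trans ?_ (measure_mono hsub)
    rw [volume_box, ← ENNReal.ofReal_mul (by rw [sub_neg_eq_add]; positivity)]
    apply ENNReal.ofReal_le_ofReal
    have h1 : (ρ / t - -(ρ / t)) * (t - t / 2) = ρ := by field_simp; ring
    rw [h1]
    exact min_le_left _ _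
  have hsum : Lam L N + Lam L G' ≤ Theta L (Function.update e 0 (e 0 - δ)) := by
    refine h.Lam_add_le_Theta hNm hG'm (b := b) inter_subset_right (fun i hi => ?_) ?_
    · rw [hG'v, hNG, Function.update_of_ne hi]
    · rw [Function.update_self, ENNReal.ofReal_sub _ hδ0.le]
      refine ENNReal.le_sub_of_add_le_right ENNReal.ofReal_ne_top ?_
      rw [← hNG 0, ← hG'v 0, ← measure_union_add_inter _ (hG'm 0)]
      gcongr
  rw [h.Lam_preimage_dilation hGm hσ0.ne'] at hsum
  have hfin : Lam L N + Lam L G ≠ ∞ := ENNReal.add_ne_top.2 ⟨hfinN, hfinG⟩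
  have : Lam L N + Lam L G + γ' < Lam L N + Lam L G + γ' :=
    calc _ ≤ Theta L e := le_trans (by gcongr) hγ'
      _ ≤ Lam L N + Lam L G + c := hΘ
      _ < _ := ENNReal.add_lt_add_left hfin hc2
  exact lt_irrefl _ this

/-! ### From symmetrized sets to profiles -/

theorem ae_coords_ne_zero : ∀ᵐ p : ℝ × ℝ, p.1 ≠ 0 ∧ p.2 ≠ 0 := by
  have h₁ : ∀ᵐ p : ℝ × ℝ, p.1 ≠ 0 := by
    rw [ae_iff]
    have : {p : ℝ × ℝ | ¬ p.1 ≠ 0} = ({0} : Set ℝ) ×ˢ (univ : Set ℝ) := by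
      ext p; simp
    rw [this, Measure.volume_eq_prod, Measure.prod_prod]
    simp
  have h₂ : ∀ᵐ p : ℝ × ℝ, p.2 ≠ 0 := by
    rw [ae_iff]
    have : {p : ℝ × ℝ | ¬ p.2 ≠ 0} = (univ : Set ℝ) ×ˢ ({0} : Set ℝ) := by
      ext p; simp
    rw [this, Measure.volume_eq_prod, Measure.prod_prod]
    simp
  exact h₁.and h₂

theorem exists_profile (E : Set (ℝ × ℝ)) :
    ∃ f : ℝ → ℝ≥0∞, Antitone f ∧ dagger E =ᵐ[volume] profileSet f := by
  -- The truncation `max t 0` makes the profile antitone on all of ℝ; only its values at |y| matter.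
  refine ⟨fun t => volume {x | (x, max t 0) ∈ vertSteiner E} / 2, ?_, ?_⟩
  · intro s t hst
    refine ENNReal.div_le_div_right (measure_mono ?_) 2
    rintro x ⟨hx₁, hx₂⟩
    refine ⟨hx₁, le_trans ?_ hx₂⟩
    apply ENNReal.ofReal_le_ofReal
    dsimp only
    rw [abs_of_nonneg (le_max_right _ _), abs_of_nonneg (le_max_right _ _)]
    exact max_le_max_right 0 hst
  · rw [eventuallyEq_set]
    filter_upwards [ae_coords_ne_zero] with p ⟨hp, _⟩
    have hslice : {x | (x, max |p.2| 0) ∈ vertSteiner E} = {x | (x, p.2) ∈ vertSteiner E} := by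
      rw [max_eq_left (abs_nonneg _)]
      ext x
      simp [vertSteiner]
    rw [mem_profileSet, hslice]
    refine ⟨fun h => h.2, fun h => ⟨?_, h⟩⟩
    have h1 : 0 < ENNReal.ofReal |p.1| := by simpa using hp
    by_contra hcon
    rw [nonpos_iff_eq_zero.1 (not_lt.1 hcon), ENNReal.zero_div] at h
    exact h1.not_ge h

theorem image_dilation {t : ℝ} (ht : t ≠ 0) (S : Set (ℝ × ℝ)) :
    dilation t '' S = dilation t⁻¹ ⁻¹' S := by
  refine congrFun (image_eq_preimage_of_inverse (fun p => ?_) (fun p => ?_)) S <;>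
    simp [dilation, ht]

theorem preimage_dilation_profileSet {t : ℝ} (ht : 0 < t) (f : ℝ → ℝ≥0∞) :
    dilation t⁻¹ ⁻¹' profileSet f = profileSet fun s => ENNReal.ofReal t * f (t * s) := by
  ext p
  rw [mem_preimage, mem_profileSet, mem_profileSet]
  simp only [dilation, inv_inv, abs_mul, abs_of_pos ht, abs_of_pos (inv_pos.2 ht)]
  rw [inv_mul_eq_div, ENNReal.ofReal_div_of_pos ht,
    ENNReal.div_le_iff (by simpa using ht) ENNReal.ofReal_ne_top, mul_comm]

/-! ### Tightness of normalized maximizing sequences -/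

/-- Pigeonhole: levels spaced by the ratio K/κ have disjoint bands, and m > E/ω bands cannot all
carry mass above ω. The number m does not depend on the sets or on b₀. -/
theorem exists_small_band {ω E κ K : ℝ} (hω : 0 < ω) (hE : 0 < E) (hκ : 0 < κ) (hκK : κ < K) :
    ∃ m : ℕ, ∀ S : Fin 4 → Set (ℝ × ℝ), (∀ i, MeasurableSet (S i)) →
      ∑ i, volume (S i) ≤ ENNReal.ofReal E → ∀ b₀ : ℝ, 0 < b₀ →
      ∃ j < m, ∀ i, volume (S i ∩ band (κ * (b₀ * (K / κ) ^ j)) (K * (b₀ * (K / κ) ^ j))) ≤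
        ENNReal.ofReal ω := by
  obtain ⟨m, hm⟩ := exists_nat_gt (E / ω)
  refine ⟨m, fun S hS hSE b₀ hb₀ => ?_⟩
  by_contra hcon
  push Not at hcon
  set R := K / κ with hR
  have hR1 : 1 ≤ R := by rw [hR, one_le_div hκ]; exact hκK.le
  set Q : ℕ → Set (ℝ × ℝ) := fun j => band (κ * (b₀ * R ^ j)) (K * (b₀ * R ^ j)) with hQ
  have hK : ∀ j, K * (b₀ * R ^ j) = κ * (b₀ * R ^ (j + 1)) := fun j => by
    rw [hR, pow_succ]; field_simp
  have hdisj : Pairwise (Function.onFun Disjoint Q) := by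
    refine (pairwise_disjoint_on Q).2 fun i j hij => disjoint_left.2 fun p hp hp' => ?_
    rw [mem_band] at hp hp'
    have h1 : R ^ (i + 1) ≤ R ^ j := pow_le_pow_right₀ hR1 hij
    have h2 : K * (b₀ * R ^ i) ≤ κ * (b₀ * R ^ j) := by rw [hK]; gcongr
    linarith [hp.2, hp'.1]
  have h1 : ∀ i, ∑ j ∈ Finset.range m, volume (S i ∩ Q j) ≤ volume (S i) := by
    intro i
    rw [← measure_biUnion_finset]
    · exact measure_mono (iUnion₂_subset fun j _ => inter_subset_left)
    · exact fun j _ k _ hjk => (hdisj hjk).mono inter_subset_right inter_subset_right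
    · exact fun j _ => (hS i).inter (measurableSet_band _ _)
  have h2 : ∀ j ∈ Finset.range m, ENNReal.ofReal ω ≤ ∑ i, volume (S i ∩ Q j) := by
    intro j hj
    obtain ⟨i, hi⟩ := hcon j (Finset.mem_range.1 hj)
    exact hi.le.trans (Finset.single_le_sum (f := fun i => volume (S i ∩ Q j))
      (fun _ _ => zero_le) (Finset.mem_univ i))
  have h3 : (m : ℝ≥0∞) * ENNReal.ofReal ω ≤ ENNReal.ofReal E := by
    calc (m : ℝ≥0∞) * ENNReal.ofReal ω = ∑ j ∈ Finset.range m, ENNReal.ofReal ω := by simp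
      _ ≤ ∑ j ∈ Finset.range m, ∑ i, volume (S i ∩ Q j) := Finset.sum_le_sum h2
      _ = ∑ i, ∑ j ∈ Finset.range m, volume (S i ∩ Q j) := Finset.sum_comm
      _ ≤ ∑ i, volume (S i) := Finset.sum_le_sum fun i _ => h1 i
      _ ≤ _ := hSE
  rw [← ENNReal.ofReal_natCast, ← ENNReal.ofReal_mul (Nat.cast_nonneg m),
    ENNReal.ofReal_le_ofReal_iff hE.le] at h3
  rw [div_lt_iff₀ hω] at hm
  linarith

/-- Normalized maximizing sequences of profile sets lose no mass to extreme scales. -/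
theorem Splitting.tight (h : Splitting L A B C) {e : Fin 4 → ℝ} (he : ∀ i, 0 < e i)
    (hadm : Admissible L e) {f : ℕ → Fin 4 → ℝ → ℝ≥0∞} (hf : ∀ n i, Antitone (f n i))
    (hfe : ∀ n i, volume (profileSet (f n i)) = ENNReal.ofReal (e i))
    (hlim : Tendsto (fun n => Lam L fun i => profileSet (f n i)) atTop (𝓝 (Theta L e)))
    (hnorm : ∀ n, volume (profileSet (f n 0) ∩ strip 1) = ENNReal.ofReal (e 0 / 2))
    {ε : ℝ} (hε : 0 < ε) : ∃ M : ℝ, 1 ≤ M ∧ ∀ᶠ n in atTop, ∀ i,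
      volume (profileSet (f n i) \ strip M) ≤ ENNReal.ofReal ε ∧
      volume (profileSet (f n i) ∩ strip (1 / M)) ≤ ENNReal.ofReal ε := by
  obtain ⟨j₀, -, hj₀⟩ := Finset.exists_min_image Finset.univ e Finset.univ_nonempty
  -- Kept below e_0/2 so that the normalization rules out one alternative of the dichotomy.
  set ε' := min ε (e j₀ / 4) with hε'
  have hε'0 : 0 < ε' := lt_min hε (by linarith [he j₀])
  have hε'e : ∀ i, ε' < e i / 2 := fun i => by
    have := hj₀ i (Finset.mem_univ i)
    have := min_le_right ε (e j₀ / 4)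
    linarith [he j₀]
  have hε'ε : ENNReal.ofReal ε' ≤ ENNReal.ofReal ε := ENNReal.ofReal_le_ofReal (min_le_left _ _)
  obtain ⟨ω, κ, K, hω, hκ, hκ2, hK, hdich⟩ := h.dichotomy he hadm hε'0
    (fun i => (hε'e i).trans (half_lt_self (he i)))
  have hE0 : 0 < ∑ i, e i := Finset.sum_pos (fun i _ => he i) Finset.univ_nonempty
  obtain ⟨m, hm⟩ := exists_small_band hω hE0 hκ (by linarith : κ < K)
  set R := K / κ with hR
  have hR1 : 1 ≤ R := by rw [hR, one_le_div hκ]; linarith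
  have hR0 : 0 < R := by linarith
  have hRm : 0 < R ^ m := by positivity
  refine ⟨R ^ m, one_le_pow₀ hR1, ?_⟩
  have hev : ∀ᶠ n in atTop, Theta L e ≤ Lam L (fun i => profileSet (f n i)) +
      ENNReal.ofReal ω := by
    have h1 := hlim.add_const (ENNReal.ofReal ω)
    have h2 : Theta L e < Theta L e + ENNReal.ofReal ω :=
      ENNReal.lt_add_right (h.Theta_ne_top e) (by simpa using hω)
    exact (h1.eventually (lt_mem_nhds h2)).mono fun n hn => hn.le
  filter_upwards [hev] with n hn i
  have hSm : ∀ i, MeasurableSet (profileSet (f n i)) := fun i =>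
    measurableSet_profileSet (hf n i).measurable
  have hsum : ∑ i, volume (profileSet (f n i)) ≤ ENNReal.ofReal (∑ i, e i) := by
    rw [ENNReal.ofReal_sum_of_nonneg fun i _ => (he i).le]
    exact (Finset.sum_congr rfl fun i _ => hfe n i).le
  have hhalf : ENNReal.ofReal ε' < ENNReal.ofReal (e 0 / 2) :=
    (ENNReal.ofReal_lt_ofReal_iff (half_pos (he 0))).2 (hε'e 0)
  constructor
  · obtain ⟨j, hj, hjω⟩ := hm _ hSm hsum 1 one_pos
    rcases hdich (f n) (hf n) (hfe n) hn _ (by positivity) hjω with hlow | hhigh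
    · refine absurd ((hnorm n).symm.le.trans ((measure_mono ?_).trans (hlow 0))) hhalf.not_ge
      exact inter_subset_inter_right _ (strip_mono (by rw [one_mul]; exact one_le_pow₀ hR1))
    · refine (measure_mono ?_).trans ((hhigh i).trans hε'ε)
      refine sdiff_subset_sdiff_right (strip_mono ?_)
      rw [one_mul]
      exact pow_le_pow_right₀ hR1 hj.le
  -- Starting at R^(-m) keeps the level at most 1, where the normalization excludes nearly all the
  -- mass lying below; the previous case starts at 1 and searches upward.
  · obtain ⟨j, hj, hjω⟩ := hm _ hSm hsum (1 / R ^ m) (by positivity)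
    rcases hdich (f n) (hf n) (hfe n) hn _ (by positivity) hjω with hlow | hhigh
    · refine (measure_mono ?_).trans ((hlow i).trans hε'ε)
      refine inter_subset_inter_right _ (strip_mono ?_)
      exact le_mul_of_one_le_right (by positivity) (one_le_pow₀ hR1)
    · have h1 : volume (profileSet (f n 0) \ strip 1) = ENNReal.ofReal (e 0 / 2) := by
        have h2 := measure_inter_add_sdiff (μ := volume) (profileSet (f n 0))
          (measurableSet_strip 1)
        rw [hfe, hnorm] at h2
        rw [← ENNReal.add_right_inj (ENNReal.ofReal_ne_top (r := e 0 / 2)), h2,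
          ← ENNReal.ofReal_add (half_pos (he 0)).le (half_pos (he 0)).le, add_halves]
      refine absurd (h1.symm.le.trans ((measure_mono ?_).trans (hhigh 0))) hhalf.not_ge
      refine sdiff_subset_sdiff_right (strip_mono ?_)
      rw [one_div, inv_mul_le_iff₀ hRm, mul_one]
      exact pow_le_pow_right₀ hR1 hj.le

/-! ### Compactness of sets decreasing in both coordinates -/

/-- Sets that are symmetric and decreasing in both coordinates. -/
def IsSolid (T : Set (ℝ × ℝ)) : Prop :=
  ∀ p ∈ T, ∀ q : ℝ × ℝ, |q.1| ≤ |p.1| → |q.2| ≤ |p.2| → q ∈ T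

theorem isSolid_profileSet {f : ℝ → ℝ≥0∞} (hf : Antitone f) : IsSolid (profileSet f) :=
  fun _ hp _ h₁ h₂ => (ENNReal.ofReal_le_ofReal h₁).trans ((mem_profileSet.1 hp).trans (hf h₂))

/-- The interior of the limit of a sequence of solid sets, tested on rational points. -/
def solidLimit (T : ℕ → Set (ℝ × ℝ)) : Set (ℝ × ℝ) :=
  {p | ∃ a : ℚ × ℚ, |p.1| < a.1 ∧ |p.2| < a.2 ∧
    ∀ᶠ k in atTop, ((a.1 : ℝ), (a.2 : ℝ)) ∈ T k}

theorem measurableSet_solidLimit (T : ℕ → Set (ℝ × ℝ)) : MeasurableSet (solidLimit T) := by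
  have : solidLimit T = ⋃ a : ℚ × ℚ, {p | |p.1| < (a.1 : ℝ)} ∩ ({p | |p.2| < (a.2 : ℝ)} ∩
      {_p | ∀ᶠ k in atTop, ((a.1 : ℝ), (a.2 : ℝ)) ∈ T k}) := by
    ext p; simp [solidLimit]
  rw [this]
  exact MeasurableSet.iUnion fun a => (measurableSet_lt (by fun_prop) (by fun_prop)).inter
    ((measurableSet_lt (by fun_prop) (by fun_prop)).inter (MeasurableSet.const _))

theorem isSolid_solidLimit (T : ℕ → Set (ℝ × ℝ)) : IsSolid (solidLimit T) := by
  rintro p ⟨a, h₁, h₂, h⟩ q hq₁ hq₂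
  exact ⟨a, hq₁.trans_lt h₁, hq₂.trans_lt h₂, h⟩

theorem eventually_mem_of_mem_solidLimit {T : ℕ → Set (ℝ × ℝ)} (hT : ∀ k, IsSolid (T k))
    {p : ℝ × ℝ} (hp : p ∈ solidLimit T) : ∀ᶠ k in atTop, p ∈ T k := by
  obtain ⟨a, h₁, h₂, h⟩ := hp
  filter_upwards [h] with k hk
  exact hT k _ hk p (h₁.le.trans (le_abs_self _)) (h₂.le.trans (le_abs_self _))

/-- Fatou's lemma for sets, through the increasing union of tail intersections. -/
theorem measure_le_of_eventually_mem {T : ℕ → Set (ℝ × ℝ)} {F : Set (ℝ × ℝ)} {c : ℝ≥0∞}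
    (hF : ∀ p ∈ F, ∀ᶠ k in atTop, p ∈ T k) (hc : ∀ᶠ k in atTop, volume (T k) ≤ c) :
    volume F ≤ c := by
  have hmono : Monotone fun n : ℕ => ⋂ k ∈ Ici n, T k := fun n m hnm =>
    biInter_subset_biInter_left (Ici_subset_Ici.2 hnm)
  have hsub : F ⊆ ⋃ n : ℕ, ⋂ k ∈ Ici n, T k := fun p hp => by
    obtain ⟨n, hn⟩ := eventually_atTop.1 (hF p hp)
    exact mem_iUnion.2 ⟨n, mem_iInter₂.2 hn⟩
  refine (measure_mono hsub).trans ?_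
  rw [hmono.measure_iUnion]
  refine iSup_le fun n => ?_
  obtain ⟨k, hk, hnk⟩ := (hc.and (eventually_ge_atTop n)).exists
  exact (measure_mono (biInter_subset_of_mem hnk)).trans hk

theorem volume_preimage_smul_of_pos {s : ℝ} (hs : 0 < s) (F : Set (ℝ × ℝ)) :
    volume ((fun p => s • p) ⁻¹' F) = ENNReal.ofReal ((s ^ 2)⁻¹) * volume F := by
  rw [Measure.addHaar_preimage_smul _ hs.ne']
  have : Module.finrank ℝ (ℝ × ℝ) = 2 := by simp
  rw [this, abs_of_pos (by positivity)]

/-- The exceptional points lie on the boundary of the limit F: shrinking one by any s < 1 puts it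
below a rational point that is frequently, hence eventually, in T_k. So F together with these points
has measure at most s⁻²|F|, and letting s → 1 leaves them no measure. -/
theorem ae_eventually_mem_iff {T : ℕ → Set (ℝ × ℝ)} (hT : ∀ k, IsSolid (T k))
    (hconv : ∀ a : ℚ × ℚ, (∀ᶠ k in atTop, ((a.1 : ℝ), (a.2 : ℝ)) ∈ T k) ∨
      ∀ᶠ k in atTop, ((a.1 : ℝ), (a.2 : ℝ)) ∉ T k)
    (hfin : volume (solidLimit T) ≠ ∞) :
    ∀ᵐ p, ∀ᶠ k in atTop, (p ∈ T k ↔ p ∈ solidLimit T) := by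
  set F := solidLimit T with hF
  set D : Set (ℝ × ℝ) := {p | (p.1 ≠ 0 ∧ p.2 ≠ 0) ∧ p ∉ F ∧ ∃ᶠ k in atTop, p ∈ T k} with hD
  have hscale : ∀ s : ℝ, 0 < s → s < 1 → D ∪ F ⊆ (fun p => s • p) ⁻¹' F := by
    rintro s hs0 hs1 p (⟨⟨h₁, h₂⟩, -, hfreq⟩ | hp)
    · have lt : ∀ x : ℝ, x ≠ 0 → |s * x| < |x| := fun x hx => by
        rw [abs_mul, abs_of_pos hs0]
        exact mul_lt_of_lt_one_left (abs_pos.2 hx) hs1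
      obtain ⟨a, ha, ha'⟩ := exists_rat_btwn (lt p.1 h₁)
      obtain ⟨c, hc, hc'⟩ := exists_rat_btwn (lt p.2 h₂)
      refine ⟨(a, c), ha, hc, (hconv (a, c)).resolve_right fun hnot => ?_⟩
      obtain ⟨k, hk, hk'⟩ := (hfreq.and_eventually hnot).exists
      refine hk' (hT k p hk _ ?_ ?_)
      · rw [abs_of_pos ((abs_nonneg _).trans_lt ha)]; exact ha'.le
      · rw [abs_of_pos ((abs_nonneg _).trans_lt hc)]; exact hc'.le
    · have le : ∀ x : ℝ, |s * x| ≤ |x| := fun x => by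
        rw [abs_mul, abs_of_pos hs0]
        exact mul_le_of_le_one_left (abs_nonneg x) hs1.le
      exact isSolid_solidLimit T p hp _ (le _) (le _)
  have hvol : volume D + volume F ≤ 0 + volume F := by
    rw [zero_add, ← measure_union (disjoint_left.2 fun p hp hp' => hp.2.1 hp')
      (measurableSet_solidLimit T)]
    have hlim : Tendsto (fun s : ℝ => ENNReal.ofReal ((s ^ 2)⁻¹) * volume F) (𝓝[<] 1)
        (𝓝 (volume F)) := by
      have h1 : Tendsto (fun s : ℝ => (s ^ 2)⁻¹) (𝓝[<] 1) (𝓝 1) := by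
        have : ContinuousAt (fun s : ℝ => (s ^ 2)⁻¹) 1 :=
          (continuousAt_id.pow 2).inv₀ (by norm_num)
        have := this.tendsto
        simp only [one_pow, inv_one] at this
        exact this.mono_left nhdsWithin_le_nhds
      have h2 := ENNReal.Tendsto.mul_const (b := volume F) (ENNReal.tendsto_ofReal h1)
        (Or.inr hfin)
      simpa using h2
    refine ge_of_tendsto hlim ?_
    have e1 : ∀ᶠ s in 𝓝[<] (1 : ℝ), s ∈ Ioo 0 1 := Ioo_mem_nhdsLT one_pos
    filter_upwards [e1] with s hs
    rw [← volume_preimage_smul_of_pos hs.1]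
    exact measure_mono (hscale s hs.1 hs.2)
  have hD0 : volume D = 0 := nonpos_iff_eq_zero.1 ((ENNReal.add_le_add_iff_right hfin).1 hvol)
  have hDae : ∀ᵐ p, p ∉ D := measure_eq_zero_iff_ae_notMem.1 hD0
  filter_upwards [hDae, ae_coords_ne_zero] with p hp hp0
  by_cases hpF : p ∈ F
  · exact (eventually_mem_of_mem_solidLimit hT hpF).mono fun k hk => iff_of_true hk hpF
  · have : ¬ ∃ᶠ k in atTop, p ∈ T k := fun h' => hp ⟨hp0, hpF, h'⟩
    exact (not_frequently.1 this).mono fun k hk => iff_of_false hk hpF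

/-- Sequential compactness of the countable product of copies of `Bool`; convergence in a discrete
space means being eventually constant. -/
theorem exists_subseq_eventually_const {ι : Type*} [Countable ι] (P : ℕ → ι → Prop) :
    ∃ φ : ℕ → ℕ, StrictMono φ ∧ ∀ a, (∀ᶠ k in atTop, P (φ k) a) ∨ ∀ᶠ k in atTop, ¬ P (φ k) a := by
  classical
  obtain ⟨x, φ, hφ, hx⟩ := CompactSpace.tendsto_subseq fun n (a : ι) => decide (P n a)
  refine ⟨φ, hφ, fun a => ?_⟩
  have h := tendsto_pi_nhds.1 hx a
  rw [nhds_discrete, tendsto_pure] at h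
  cases hxa : x a
  · right
    filter_upwards [h] with k hk
    simpa [hxa] using hk
  · left
    filter_upwards [h] with k hk
    simpa [hxa] using hk

/-- A tight sequence of solid sets converging on rational points converges in measure. -/
theorem tendsto_volume_symmDiff_solidLimit {f : ℕ → ℝ → ℝ≥0∞} (hf : ∀ k, Antitone (f k)) {E : ℝ}
    (hE0 : 0 ≤ E) (hE : ∀ k, volume (profileSet (f k)) ≤ ENNReal.ofReal E)
    (hconv : ∀ a : ℚ × ℚ, (∀ᶠ k in atTop, ((a.1 : ℝ), (a.2 : ℝ)) ∈ profileSet (f k)) ∨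
      ∀ᶠ k in atTop, ((a.1 : ℝ), (a.2 : ℝ)) ∉ profileSet (f k))
    (htight : ∀ ε : ℝ, 0 < ε → ∃ M : ℝ, 1 ≤ M ∧ ∀ᶠ k in atTop,
      volume (profileSet (f k) \ strip M) ≤ ENNReal.ofReal ε ∧
      volume (profileSet (f k) ∩ strip (1 / M)) ≤ ENNReal.ofReal ε) :
    volume (solidLimit fun k => profileSet (f k)) < ∞ ∧
    Tendsto (fun k => volume (symmDiff (solidLimit fun k => profileSet (f k))
      (profileSet (f k)))) atTop (𝓝 0) := by
  set T : ℕ → Set (ℝ × ℝ) := fun k => profileSet (f k) with hT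
  set F := solidLimit T with hF
  have hsol : ∀ k, IsSolid (T k) := fun k => isSolid_profileSet (hf k)
  have hTm : ∀ k, MeasurableSet (T k) := fun k => measurableSet_profileSet (hf k).measurable
  have hFm : MeasurableSet F := measurableSet_solidLimit T
  have hFT : ∀ p ∈ F, ∀ᶠ k in atTop, p ∈ T k := fun p =>
    eventually_mem_of_mem_solidLimit hsol
  have hFE : volume F ≤ ENNReal.ofReal E :=
    measure_le_of_eventually_mem hFT (Eventually.of_forall hE)
  have hFfin : volume F < ∞ := hFE.trans_lt ENNReal.ofReal_lt_top
  refine ⟨hFfin, ENNReal.tendsto_nhds_zero.2 fun η hη => ?_⟩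
  -- Five pieces: the difference in the middle band, and the top and bottom tails of both the limit
  -- and T_k.
  obtain ⟨ε, hε0, hε⟩ : ∃ ε : ℝ, 0 < ε ∧ 5 * ENNReal.ofReal ε ≤ η := by
    have h5 : (0 : ℝ≥0∞) < η / 5 := ENNReal.div_pos hη.ne' (by norm_num)
    obtain ⟨r, hr0, hr⟩ := ENNReal.lt_iff_exists_nnreal_btwn.1 h5
    refine ⟨r, by simpa using hr0, ?_⟩
    rw [ENNReal.ofReal_coe_nnreal, mul_comm]
    exact ENNReal.mul_le_of_le_div hr.le
  obtain ⟨M, hM, hMε⟩ := htight ε hε0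
  have hM0 : 0 < M := by linarith
  set W : Set (ℝ × ℝ) := {p | p.1 ∈ Icc (-(E * M)) (E * M) ∧ p.2 ∈ Icc (-M) M} with hW
  have hWprod : W = Icc (-(E * M)) (E * M) ×ˢ Icc (-M) M := rfl
  have hWm : MeasurableSet W := by
    rw [hWprod]; exact measurableSet_Icc.prod measurableSet_Icc
  have hWfin : volume W ≠ ∞ := by
    rw [hWprod, Measure.volume_eq_prod, Measure.prod_prod, Real.volume_Icc, Real.volume_Icc]
    exact ENNReal.mul_ne_top ENNReal.ofReal_ne_top ENNReal.ofReal_ne_top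
  have hTW : ∀ k, T k ∩ band (1 / M) M ⊆ W := by
    rintro k p ⟨hp, hp1, hp2⟩
    refine ⟨abs_le.1 ?_, abs_le.1 hp2⟩
    have h1 : ENNReal.ofReal |p.1| ≤ ENNReal.ofReal E / ENNReal.ofReal (1 / M) :=
      (mem_profileSet.1 hp).trans ((hf k hp1.le).trans
        (profile_le_div (hf k) (by positivity) (hE k)))
    rw [← ENNReal.ofReal_div_of_pos (by positivity), div_div_eq_mul_div, div_one] at h1
    exact (ENNReal.ofReal_le_ofReal_iff (by positivity)).1 h1
  have hFW : F ∩ band (1 / M) M ⊆ W := fun p hp => by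
    obtain ⟨k, hk⟩ := (hFT p hp.1).exists
    exact hTW k ⟨hk, hp.2⟩
  have hmid : Tendsto (fun k => volume (symmDiff F (T k) ∩ band (1 / M) M)) atTop (𝓝 0) := by
    have h1 := tendsto_measure_of_ae_tendsto_indicator (μ := volume) atTop (A := ∅)
      (As := fun k => symmDiff F (T k) ∩ band (1 / M) M) MeasurableSet.empty
      (fun k => (hFm.symmDiff (hTm k)).inter (measurableSet_band _ _)) hWm hWfin
      (Eventually.of_forall fun k p hp => by
        rcases hp.1 with h | h
        · exact hFW ⟨h.1, hp.2⟩
        · exact hTW k ⟨h.1, hp.2⟩) (by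
        filter_upwards [ae_eventually_mem_iff hsol hconv hFfin.ne] with p hp
        filter_upwards [hp] with k hk
        rw [← hF] at hk
        simp [mem_symmDiff, hk])
    simpa using h1
  have hF1 : volume (F \ strip M) ≤ ENNReal.ofReal ε := by
    refine measure_le_of_eventually_mem (T := fun k => T k \ strip M) ?_ (hMε.mono fun k hk => hk.1)
    exact fun p hp => (hFT p hp.1).mono fun k hk => ⟨hk, hp.2⟩
  have hF2 : volume (F ∩ strip (1 / M)) ≤ ENNReal.ofReal ε := by
    refine measure_le_of_eventually_mem (T := fun k => T k ∩ strip (1 / M)) ?_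
      (hMε.mono fun k hk => hk.2)
    exact fun p hp => (hFT p hp.1).mono fun k hk => ⟨hk, hp.2⟩
  filter_upwards [hMε, hmid.eventually (eventually_le_nhds (ENNReal.ofReal_pos.2 hε0))]
    with k ⟨hk1, hk2⟩ hk3
  have hsub : symmDiff F (T k) ⊆ ((symmDiff F (T k) ∩ band (1 / M) M ∪ F \ strip M) ∪
      F ∩ strip (1 / M)) ∪ T k \ strip M ∪ T k ∩ strip (1 / M) := by
    intro p hp
    by_cases h1 : |p.2| ≤ 1 / M
    · rcases hp with h | h
      · exact Or.inl (Or.inl (Or.inr ⟨h.1, h1⟩))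
      · exact Or.inr ⟨h.1, h1⟩
    by_cases h2 : |p.2| ≤ M
    · exact Or.inl (Or.inl (Or.inl (Or.inl ⟨hp, not_le.1 h1, h2⟩)))
    · rcases hp with h | h
      · exact Or.inl (Or.inl (Or.inl (Or.inr ⟨h.1, h2⟩)))
      · exact Or.inl (Or.inr ⟨h.1, h2⟩)
  calc volume (symmDiff F (T k)) ≤ _ := measure_mono hsub
    _ ≤ ENNReal.ofReal ε + ENNReal.ofReal ε + ENNReal.ofReal ε + ENNReal.ofReal ε +
        ENNReal.ofReal ε := by
        refine (measure_union_le _ _).trans (add_le_add ?_ hk2)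
        refine (measure_union_le _ _).trans (add_le_add ?_ hk1)
        refine (measure_union_le _ _).trans (add_le_add ?_ hF2)
        exact (measure_union_le _ _).trans (add_le_add hk3 hF1)
    _ = 5 * ENNReal.ofReal ε := by ring
    _ ≤ η := hε

end PartialSymm

/-! ### Normalization, extraction of the subsequence, and conclusion -/

open PartialSymm in
theorem theorem4p2 (L : PartialSymm.MapTuple)
    (hsymm : PartialSymm.PartialSymmetry L) (hnd : PartialSymm.Nondegenerate L)
    (e : Fin 4 → ℝ) (he : ∀ i, 0 < e i) (hadm : PartialSymm.Admissible L e)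
    (E : ℕ → Fin 4 → Set (ℝ × ℝ))
    (hmeas : ∀ n, PartialSymm.HasMeasures (E n) e)
    (hlim : Tendsto (fun n => PartialSymm.Lam L (E n)) atTop (𝓝 (PartialSymm.Theta L e)))
    (hdagger : ∀ n i, PartialSymm.dagger (E n i) =ᵐ[volume] E n i) :
    ∃ (φ : ℕ → ℕ) (lam : ℕ → ℝ) (F : Fin 4 → Set (ℝ × ℝ)),
      StrictMono φ ∧ (∀ k, 0 < lam k) ∧
      (∀ i, NullMeasurableSet (F i) volume ∧ volume (F i) < ∞) ∧
      ∀ i, Tendsto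
        (fun k => volume (symmDiff (F i) (PartialSymm.dilation (lam k) '' E (φ k) i)))
        atTop (𝓝 0) := by
  obtain ⟨A, B, C, h⟩ := exists_splitting L hsymm hnd
  choose f hf hfdagger using fun n i => exists_profile (E n i)
  have hfE : ∀ n i, E n i =ᵐ[volume] profileSet (f n i) := fun n i =>
    (hdagger n i).symm.trans (hfdagger n i)
  have hfe : ∀ n i, volume (profileSet (f n i)) = ENNReal.ofReal (e i) := fun n i => by
    rw [← measure_congr (hfE n i), (hmeas n i).2]
  have hfm : ∀ n i, MeasurableSet (profileSet (f n i)) := fun n i =>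
    measurableSet_profileSet (hf n i).measurable
  -- The median height of the 0-th set serves as the dilation parameter: D_r carries the strip |y| ≤
  -- r to |y| ≤ 1.
  have hr : ∀ n, ∃ r : ℝ, 0 < r ∧
      volume (profileSet (f n 0) ∩ strip r) = ENNReal.ofReal (e 0 / 2) := fun n => by
    refine exists_strip_measure_eq (hfm n 0) (fun r => ?_) (by simpa using he 0) ?_
    · exact ne_top_of_le_ne_top ((hfe n 0).trans_ne ENNReal.ofReal_ne_top)
        (measure_mono inter_subset_left)
    · rw [hfe]
      exact (ENNReal.ofReal_lt_ofReal_iff (he 0)).2 (half_lt_self (he 0))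
  choose r hr0 hr using hr
  set g : ℕ → Fin 4 → ℝ → ℝ≥0∞ := fun n i s => ENNReal.ofReal (r n) * f n i (r n * s) with hg
  have hgf : ∀ n i, profileSet (g n i) = dilation (r n)⁻¹ ⁻¹' profileSet (f n i) := fun n i =>
    (preimage_dilation_profileSet (hr0 n) _).symm
  have hganti : ∀ n i, Antitone (g n i) := fun n i s t hst =>
    mul_le_mul_right (hf n i (mul_le_mul_of_nonneg_left hst (hr0 n).le)) _
  have hpres : ∀ n, MeasurePreserving (dilation (r n)⁻¹) := fun n =>
    measurePreserving_dilation (inv_ne_zero (hr0 n).ne')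
  have hge : ∀ n i, volume (profileSet (g n i)) = ENNReal.ofReal (e i) := fun n i => by
    rw [hgf, (hpres n).measure_preimage (hfm n i).nullMeasurableSet, hfe]
  have hglim : Tendsto (fun n => Lam L fun i => profileSet (g n i)) atTop (𝓝 (Theta L e)) := by
    convert hlim using 2 with n
    simp only [hgf]
    rw [h.Lam_preimage_dilation (hfm n) (inv_ne_zero (hr0 n).ne')]
    exact (h.Lam_congr (hfE n)).symm
  have hnorm : ∀ n, volume (profileSet (g n 0) ∩ strip 1) = ENNReal.ofReal (e 0 / 2) := by
    intro n
    have hstrip : strip 1 = dilation (r n)⁻¹ ⁻¹' strip (r n) := by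
      ext p
      simp only [mem_preimage, mem_strip, dilation, inv_inv, abs_mul, abs_of_pos (hr0 n)]
      exact (mul_le_iff_le_one_right (hr0 n)).symm
    rw [hgf, hstrip, ← preimage_inter, (hpres n).measure_preimage
      ((hfm n 0).inter (measurableSet_strip _)).nullMeasurableSet, hr]
  -- Including the index i in the countable family gives one subsequence for all four sets.
  obtain ⟨φ, hφ, hconv⟩ := exists_subseq_eventually_const
    fun n (a : Fin 4 × ℚ × ℚ) => ((a.2.1 : ℝ), (a.2.2 : ℝ)) ∈ profileSet (g n a.1)
  have hmain := fun i => tendsto_volume_symmDiff_solidLimit (f := fun k => g (φ k) i)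
    (fun k => hganti (φ k) i) (he i).le
    (fun k => (hge (φ k) i).le) (fun a => hconv (i, a))
    fun ε hε => by
      obtain ⟨M, hM, hev⟩ := h.tight he hadm hganti hge hglim hnorm hε
      exact ⟨M, hM, (hφ.tendsto_atTop.eventually hev).mono fun k hk => hk i⟩
  refine ⟨φ, fun k => r (φ k), fun i => solidLimit fun k => profileSet (g (φ k) i), hφ,
    fun k => hr0 _, fun i => ⟨(measurableSet_solidLimit _).nullMeasurableSet, (hmain i).1⟩,
    fun i => ?_⟩
  refine (hmain i).2.congr fun k => measure_congr (ae_eq_set_symmDiff (ae_eq_refl _) ?_)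
  rw [image_dilation (hr0 _).ne', hgf]
  exact (hpres _).quasiMeasurePreserving.preimage_ae_eq (hfE _ _).symm
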